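/- Let $X$, $Y$, $Z$ be finite alphabets and let $p(y,z|x)$ be a discrete memoryless wiretap channel with input alphabet $X$, legitimate-receiver output alphabet $Y$ and eavesdropper output alphabet $Z$; $n$ uses of it have transition probability $\prod_{i=1}^n p(y_i,z_i|x_i)$. A code of block length $n$ for a message $W$ uniformly distributed on a finite nonempty set $\mathcal W$ consists of a stochastic encoder, i.e. a probability distribution on $X^n$ for each $w\in\mathcal W$, and a decoder $Y^n\to\mathcal W$; its error probability is the probability that the decoder's output differs from $W$. Entropies and mutual informations are in bits. A pair $(R,R_e)$ is an achievable rate-equivocation pair if there are codes, one for each block length $n$, for messages $W$ uniform on sets of size $M_n\ge 1$ with $\frac1n\log_2 M_n\to R$, with error probability tending to $0$, such that for every $\epsilon>0$ one has $\frac1n H(W|Z^n)\ge R_e-\epsilon$ for all sufficiently large $n$. A pair $(R_p,R_s)$ is an achievable private-confidential rate pair if there are codes, one for each block length $n$, for pairs $W=(W_p,W_s)$ of independent messages uniform on sets of sizes $M_{p,n},M_{s,n}\ge1$ with $\frac1n\log_2 M_{p,n}\to R_p$ and $\frac1n\log_2 M_{s,n}\to R_s$, with error probability (of the pair) tending to $0$,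 such that for every $\epsilon>0$ one has $\frac1n I(W_s;Z^n)\le\epsilon$ for all sufficiently large $n$. Then a nonnegative pair $(R,R_e)=(R_p+R_s,R_s)$ is an achievable rate-equivocation pair for a discrete memoryless wiretap channel if and only if $(R_p,R_s)$ is an achievable private-confidential rate pair for the same channel. -/

import Mathlib

namespace Wiretap

open Filter Topology

section Information

variable {α β : Type*} [Fintype α] [Fintype β]

/-- Conditional entropy `H(A|B)`, in bits, of a pair `(A, B)` with joint probability mass
function `p`; the terms with `p (a, b) = 0` contribute `0`. -/
noncomputable def condEntropy (p : α × β → ℝ) : ℝ :=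
  -∑ a, ∑ b, p (a, b) * Real.logb 2 (p (a, b) / ∑ a', p (a', b))

/-- Mutual information `I(A;B)`, in bits, of a pair `(A, B)` with joint probability mass
function `p`; the terms with `p (a, b) = 0` contribute `0`. -/
noncomputable def mutualInfo (p : α × β → ℝ) : ℝ :=
  ∑ a, ∑ b, p (a, b) * Real.logb 2 (p (a, b) / ((∑ b', p (a, b')) * ∑ a', p (a', b)))

end Information

/-- A discrete memoryless wiretap channel `p(y, z | x)` with input alphabet `X`, output alphabet
`Y` at the legitimate receiver and output alphabet `Z` at the eavesdropper: a probability vector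
on `Y × Z` for every input letter. -/
abbrev Channel (X Y Z : Type*) [Fintype Y] [Fintype Z] : Type _ :=
  X → stdSimplex ℝ (Y × Z)

/-- A code of block length `n` for messages in `𝓦`: a stochastic encoder, which maps a message to
a probability distribution on input words, and a decoder at the legitimate receiver. -/
structure Code (𝓦 X Y : Type*) [Fintype X] (n : ℕ) where
  enc : 𝓦 → stdSimplex ℝ (Fin n → X)
  dec : (Fin n → Y) → 𝓦

section Code

variable {𝓦 X Y Z : Type*} [Fintype 𝓦] [Fintype X] [Fintype Y] [Fintype Z] {n : ℕ}

/-- The joint probability mass function of `(W, Yⁿ, Zⁿ)` when the message `W` is uniform on `𝓦`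
and the input word chosen by the encoder is sent over `n` memoryless uses of the channel. -/
noncomputable def Code.joint (c : Code 𝓦 X Y n) (ch : Channel X Y Z)
    (w : 𝓦) (y : Fin n → Y) (z : Fin n → Z) : ℝ :=
  (Fintype.card 𝓦 : ℝ)⁻¹ * ∑ x : Fin n → X, (c.enc w).1 x * ∏ i, (ch (x i)).1 (y i, z i)

/-- The (average) probability that the decoder at the legitimate receiver is wrong. -/
noncomputable def Code.errorProb [DecidableEq 𝓦] (c : Code 𝓦 X Y n) (ch : Channel X Y Z) : ℝ :=
  ∑ w, ∑ y, ∑ z, if c.dec y = w then 0 else c.joint ch w y z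

/-- The joint probability mass function of the message and the eavesdropper's observation,
`(W, Zⁿ)`. -/
noncomputable def Code.eavesdropper (c : Code 𝓦 X Y n) (ch : Channel X Y Z) :
    𝓦 × (Fin n → Z) → ℝ :=
  fun q => ∑ y, c.joint ch q.1 y q.2

/-- The equivocation `H(W|Zⁿ)`. -/
noncomputable def Code.equivocation (c : Code 𝓦 X Y n) (ch : Channel X Y Z) : ℝ :=
  condEntropy (c.eavesdropper ch)

/-- For a message pair `W = (Wₚ, Wₛ)` (uniform on the product, so that the two messages are
uniform and independent): the leakage `I(Wₛ;Zⁿ)` of the second message. -/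
noncomputable def Code.leakage {P S : Type*} [Fintype P] [Fintype S]
    (c : Code (P × S) X Y n) (ch : Channel X Y Z) : ℝ :=
  mutualInfo fun q : S × (Fin n → Z) => ∑ p, c.eavesdropper ch ((p, q.1), q.2)

end Code

variable {X Y Z : Type*} [Fintype X] [Fintype Y] [Fintype Z]

/-- `(R, Rₑ)` is an achievable rate-equivocation pair: there are codes of all block lengths `n`
for a message of asymptotic rate `R`, with vanishing error probability, such that for every
`ε > 0` one has `H(W|Zⁿ)/n ≥ Rₑ - ε` for all sufficiently large `n`. -/
def AchievableRateEquivocation (ch : Channel X Y Z) (R Re : ℝ) : Prop :=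
  ∃ (M : ℕ → ℕ) (c : ∀ n, Code (Fin (M n)) X Y n),
    (∀ n, 0 < M n) ∧
    Tendsto (fun n : ℕ => Real.logb 2 (M n) / n) atTop (𝓝 R) ∧
    Tendsto (fun n => (c n).errorProb ch) atTop (𝓝 0) ∧
    ∀ ε : ℝ, 0 < ε → ∀ᶠ n : ℕ in atTop, Re - ε ≤ (c n).equivocation ch / n

/-- `(Rₚ, Rₛ)` is an achievable private-confidential rate pair: there are codes of all block
lengths `n` for a private message `Wₚ` and a confidential message `Wₛ` of asymptotic rates `Rₚ`
and `Rₛ`, with vanishing error probability, such that for every `ε > 0` one has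
`I(Wₛ;Zⁿ)/n ≤ ε` for all sufficiently large `n`. -/
def AchievablePrivateConfidential (ch : Channel X Y Z) (Rp Rs : ℝ) : Prop :=
  ∃ (Mp Ms : ℕ → ℕ) (c : ∀ n, Code (Fin (Mp n) × Fin (Ms n)) X Y n),
    (∀ n, 0 < Mp n ∧ 0 < Ms n) ∧
    Tendsto (fun n : ℕ => Real.logb 2 (Mp n) / n) atTop (𝓝 Rp) ∧
    Tendsto (fun n : ℕ => Real.logb 2 (Ms n) / n) atTop (𝓝 Rs) ∧
    Tendsto (fun n => (c n).errorProb ch) atTop (𝓝 0) ∧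
    ∀ ε : ℝ, 0 < ε → ∀ᶠ n : ℕ in atTop, (c n).leakage ch / n ≤ ε

end Wiretap

/-!
A message pair is a single message whose equivocation is at least that of the confidential part,
`H(Wₚ,Wₛ|Zⁿ) ≥ H(Wₛ|Zⁿ) = log Mₛ - I(Wₛ;Zⁿ)` (`Code.logb_card_sub_leakage_le`); this gives a
rate-equivocation code from a private-confidential one.

In the other direction one code is not enough: a large equivocation is a statement about an average,
and does not provide a part of the message about which the eavesdropper learns nothing. So a fixed
number `K` of good codes is concatenated (`Code.concat`), of lengths that differ by at most one and
add up to the block length `N`. The information density of the message and the eavesdropper's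
observation is then a sum of `K` independent terms. Its mean is at most about `N Rₚ`, since
`I(W;Zⁿ) = log M - H(W|Zⁿ)`, and its standard deviation is `O(N/√K)`, because the second moment of
an information density is `O((log M)²)` for every stochastic matrix
(`expect_logb_infoRatio_sq_le`, `expect_prodMatrix_logb_le`).

The messages of the concatenated code are arranged by a random permutation into a table with about
`2^(N Rₛ)` columns and `2^(N Rₚ)` rows, up to at most half of them, which are left out. The column
is the confidential message, the row the private one. By soft covering
(`exists_perm_mutualInfo_le`) the leakage of the column is on average at most
`𝔼 log (1 + ratio / Mₚ)`, where `ratio` is the likelihood ratio with logarithm the information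
density; by the concentration above this is at most `N ε` for large `K` and `N`. Leaving out
messages at most doubles the error probability, so every arrangement has a small one. The proof of
soft covering compares the output distributions of the columns with that of the whole table and
applies the concavity of the logarithm; it uses only that a random permutation maps any two
distinct points to a uniformly distributed pair of distinct points.

As `K` depends on the accuracy, a diagonal argument (`exists_seq_tendsto_zero`) concludes.
-/

namespace Wiretap

open Filter Topology

/-! ### Entropy and mutual information -/

/-- The concavity of the logarithm, in the form of a tangent line at `c`. -/
lemma logb_two_le_logb_add {x c : ℝ} (hx : 0 < x) (hc : 0 < c) :
    Real.logb 2 x ≤ Real.logb 2 c + (x / c - 1) / Real.log 2 := by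
  have h2 : 0 < Real.log 2 := Real.log_pos one_lt_two
  have h := Real.log_le_sub_one_of_pos (div_pos hx hc)
  rw [Real.log_div hx.ne' hc.ne'] at h
  rw [Real.logb, Real.logb, ← add_div]
  gcongr
  linarith

section Information

variable {α β : Type*} [Fintype α] [Fintype β]

/-- Replacing the second marginal of `p` by any other probability vector `r` in the definition of
`I(A;B)` can only increase the value: the difference is a relative entropy. -/
lemma mutualInfo_le_sum_logb (p : α × β → ℝ) (hp : ∀ q, 0 ≤ p q) (r : β → ℝ) (hr : ∀ b, 0 ≤ r b)
    (hsum : ∑ b, r b ≤ ∑ a, ∑ b, p (a, b)) (hac : ∀ a b, r b = 0 → p (a, b) = 0) :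
    mutualInfo p ≤ ∑ a, ∑ b, p (a, b) * Real.logb 2 (p (a, b) / ((∑ b', p (a, b')) * r b)) := by
  have h2 : 0 < Real.log 2 := Real.log_pos one_lt_two
  have key : ∀ a b, p (a, b) * Real.logb 2 (p (a, b) / ((∑ b', p (a, b')) * ∑ a', p (a', b)))
      ≤ p (a, b) * Real.logb 2 (p (a, b) / ((∑ b', p (a, b')) * r b))
        + (p (a, b) * (r b / ∑ a', p (a', b)) - p (a, b)) / Real.log 2 := by
    intro a b
    rcases (hp (a, b)).eq_or_lt with h0 | h0
    · simp [← h0]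
    have hA : 0 < ∑ b', p (a, b') :=
      h0.trans_le (Finset.single_le_sum (f := fun b' => p (a, b')) (fun i _ => hp _)
        (Finset.mem_univ b))
    have hB : 0 < ∑ a', p (a', b) :=
      h0.trans_le (Finset.single_le_sum (f := fun a' => p (a', b)) (fun i _ => hp _)
        (Finset.mem_univ a))
    have hrb : 0 < r b := lt_of_le_of_ne (hr b) fun h => h0.ne' (hac a b h.symm)
    have := logb_two_le_logb_add (x := p (a, b) / ((∑ b', p (a, b')) * ∑ a', p (a', b)))
      (c := p (a, b) / ((∑ b', p (a, b')) * r b)) (by positivity) (by positivity)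
    have e : p (a, b) / ((∑ b', p (a, b')) * ∑ a', p (a', b)) /
        (p (a, b) / ((∑ b', p (a, b')) * r b)) = r b / ∑ a', p (a', b) := by
      field_simp
    rw [e] at this
    calc _ ≤ p (a, b) * _ := mul_le_mul_of_nonneg_left this h0.le
      _ = _ := by ring
  have hle : ∑ a, ∑ b, p (a, b) * (r b / ∑ a', p (a', b)) ≤ ∑ b, r b := by
    rw [Finset.sum_comm]
    refine Finset.sum_le_sum fun b _ => ?_
    rw [← Finset.sum_mul]
    rcases (Finset.sum_nonneg fun a (_ : a ∈ Finset.univ) => hp (a, b)).eq_or_lt with h | h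
    · rw [← h]; simpa using hr b
    · rw [mul_div_cancel₀ _ h.ne']
  calc mutualInfo p ≤ ∑ a, ∑ b, (p (a, b) * Real.logb 2 (p (a, b) / ((∑ b', p (a, b')) * r b))
        + (p (a, b) * (r b / ∑ a', p (a', b)) - p (a, b)) / Real.log 2) :=
        Finset.sum_le_sum fun a _ => Finset.sum_le_sum fun b _ => key a b
    _ = (∑ a, ∑ b, p (a, b) * Real.logb 2 (p (a, b) / ((∑ b', p (a, b')) * r b)))
        + ((∑ a, ∑ b, p (a, b) * (r b / ∑ a', p (a', b))) - ∑ a, ∑ b, p (a, b)) / Real.log 2 := by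
        simp only [Finset.sum_add_distrib, ← Finset.sum_div, Finset.sum_sub_distrib]
    _ ≤ _ := by
        have : ((∑ a, ∑ b, p (a, b) * (r b / ∑ a', p (a', b))) - ∑ a, ∑ b, p (a, b))
            / Real.log 2 ≤ 0 := div_nonpos_of_nonpos_of_nonneg (by linarith) h2.le
        linarith

lemma mutualInfo_nonneg (p : α × β → ℝ) (hp : ∀ q, 0 ≤ p q) (h1 : ∑ a, ∑ b, p (a, b) = 1) :
    0 ≤ mutualInfo p := by
  have h2 : 0 < Real.log 2 := Real.log_pos one_lt_two
  have key : ∀ a b, (p (a, b) - (∑ b', p (a, b')) * ∑ a', p (a', b)) / Real.log 2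
      ≤ p (a, b) * Real.logb 2 (p (a, b) / ((∑ b', p (a, b')) * ∑ a', p (a', b))) := by
    intro a b
    have hA0 : 0 ≤ ∑ b', p (a, b') := Finset.sum_nonneg fun _ _ => hp _
    have hB0 : 0 ≤ ∑ a', p (a', b) := Finset.sum_nonneg fun _ _ => hp _
    rcases (hp (a, b)).eq_or_lt with h0 | h0
    · rw [← h0, zero_mul, zero_sub]
      exact div_nonpos_of_nonpos_of_nonneg (by linarith [mul_nonneg hA0 hB0]) h2.le
    have hA : 0 < ∑ b', p (a, b') :=
      h0.trans_le (Finset.single_le_sum (f := fun b' => p (a, b')) (fun i _ => hp _)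
        (Finset.mem_univ b))
    have hB : 0 < ∑ a', p (a', b) :=
      h0.trans_le (Finset.single_le_sum (f := fun a' => p (a', b)) (fun i _ => hp _)
        (Finset.mem_univ a))
    have := logb_two_le_logb_add one_pos
      (c := p (a, b) / ((∑ b', p (a, b')) * ∑ a', p (a', b))) (by positivity)
    rw [Real.logb_one] at this
    have := mul_le_mul_of_nonneg_left this h0.le
    rw [mul_zero] at this
    have e : p (a, b) * (1 / (p (a, b) / ((∑ b', p (a, b')) * ∑ a', p (a', b))))
        = (∑ b', p (a, b')) * ∑ a', p (a', b) := by field_simp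
    have e' : (p (a, b) - (∑ b', p (a, b')) * ∑ a', p (a', b)) / Real.log 2
        = - (p (a, b) * ((1 / (p (a, b) / ((∑ b', p (a, b')) * ∑ a', p (a', b))) - 1)
          / Real.log 2)) := by
      rw [mul_div_assoc', mul_sub, e, mul_one, ← neg_div, neg_sub]
    rw [e']
    linarith
  have h1' : ∑ b, ∑ a, p (a, b) = 1 := by rw [Finset.sum_comm, h1]
  calc (0 : ℝ) = ∑ a, ∑ b, (p (a, b) - (∑ b', p (a, b')) * ∑ a', p (a', b)) / Real.log 2 := by
        simp only [← Finset.sum_div, Finset.sum_sub_distrib, ← Finset.mul_sum, h1', mul_one,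
          sub_self, zero_div, Finset.sum_const_zero]
    _ ≤ _ := Finset.sum_le_sum fun a _ => Finset.sum_le_sum fun b _ => key a b

/-- `H(A|B) = log |A| - I(A;B)` for a uniform `A`. -/
lemma condEntropy_eq_logb_card_sub [Nonempty α] (p : α × β → ℝ) (hp : ∀ q, 0 ≤ p q)
    (hu : ∀ a, ∑ b, p (a, b) = (Fintype.card α : ℝ)⁻¹) :
    condEntropy p = Real.logb 2 (Fintype.card α) - mutualInfo p := by
  have hc : (0 : ℝ) < Fintype.card α := by exact_mod_cast Fintype.card_pos
  have key : ∀ a b, p (a, b) * Real.logb 2 (p (a, b) / ∑ a', p (a', b))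
      = p (a, b) * Real.logb 2 (p (a, b) / ((∑ b', p (a, b')) * ∑ a', p (a', b)))
        - p (a, b) * Real.logb 2 (Fintype.card α) := by
    intro a b
    rcases (hp (a, b)).eq_or_lt with h0 | h0
    · simp [← h0]
    have hB : 0 < ∑ a', p (a', b) :=
      h0.trans_le (Finset.single_le_sum (f := fun a' => p (a', b)) (fun i _ => hp _)
        (Finset.mem_univ a))
    have e : p (a, b) / ((∑ b', p (a, b')) * ∑ a', p (a', b))
        = Fintype.card α * (p (a, b) / ∑ a', p (a', b)) := by
      rw [hu]; field_simp
    rw [e, Real.logb_mul hc.ne' (by positivity)]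
    ring
  have hone : ∑ a, ∑ b, p (a, b) = 1 := by
    simp only [hu, Finset.sum_const, Finset.card_univ, nsmul_eq_mul]
    exact mul_inv_cancel₀ hc.ne'
  simp only [condEntropy, key, Finset.sum_sub_distrib, ← Finset.sum_mul, hone, mutualInfo]
  ring

/-- `H(A₁|B) ≤ H(A₀,A₁|B)`. -/
lemma condEntropy_marginal_le {γ : Type*} [Fintype γ] (p : (γ × α) × β → ℝ) (hp : ∀ q, 0 ≤ p q) :
    condEntropy (fun q : α × β => ∑ c, p ((c, q.1), q.2)) ≤ condEntropy p := by
  simp only [condEntropy, Fintype.sum_prod_type, neg_le_neg_iff]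
  rw [Finset.sum_comm]
  refine Finset.sum_le_sum fun a _ => ?_
  rw [Finset.sum_comm]
  refine Finset.sum_le_sum fun b _ => ?_
  rw [Finset.sum_mul]
  refine Finset.sum_le_sum fun c _ => ?_
  rcases (hp ((c, a), b)).eq_or_lt with h0 | h0
  · simp [← h0]
  rw [Finset.sum_comm (f := fun x x_1 => p ((x, x_1), b))]
  have h1 : p ((c, a), b) ≤ ∑ c, p ((c, a), b) :=
    Finset.single_le_sum (f := fun c => p ((c, a), b)) (fun i _ => hp _) (Finset.mem_univ c)
  have h2 : ∑ c, p ((c, a), b) ≤ ∑ a, ∑ c, p ((c, a), b) :=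
    Finset.single_le_sum (f := fun a => ∑ c, p ((c, a), b))
      (fun i _ => Finset.sum_nonneg fun _ _ => hp _) (Finset.mem_univ a)
  have h3 : 0 < ∑ a, ∑ c, p ((c, a), b) := by linarith
  refine mul_le_mul_of_nonneg_left (Real.logb_le_logb_of_le one_lt_two (by positivity) ?_) h0.le
  gcongr

end Information

/-! ### The information density of a stochastic matrix with uniform input -/

section Density

variable {W C : Type*} [Fintype W]

/-- The output distribution of a stochastic matrix `Q` for the uniform input distribution. -/
noncomputable def outputDist (Q : W → C → ℝ) (c : C) : ℝ :=
  (Fintype.card W : ℝ)⁻¹ * ∑ w, Q w c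

/-- The likelihood ratio `Q(c|w) / Q(c)`, whose logarithm is the information density of the
uniform input and the output of `Q`; it is `0` if `c` has probability `0`. -/
noncomputable def infoRatio (Q : W → C → ℝ) (w : W) (c : C) : ℝ :=
  Q w c / outputDist Q c

variable {Q : W → C → ℝ}

lemma outputDist_nonneg (h0 : ∀ w c, 0 ≤ Q w c) (c : C) : 0 ≤ outputDist Q c :=
  mul_nonneg (by positivity) (Finset.sum_nonneg fun _ _ => h0 _ _)

lemma infoRatio_nonneg (h0 : ∀ w c, 0 ≤ Q w c) (w : W) (c : C) : 0 ≤ infoRatio Q w c :=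
  div_nonneg (h0 w c) (outputDist_nonneg h0 c)

lemma outputDist_pos (h0 : ∀ w c, 0 ≤ Q w c) {w : W} {c : C} (h : 0 < Q w c) :
    0 < outputDist Q c := by
  have : Nonempty W := ⟨w⟩
  have hc : (0 : ℝ) < Fintype.card W := by exact_mod_cast Fintype.card_pos
  exact mul_pos (by positivity) (h.trans_le (Finset.single_le_sum (f := fun w => Q w c)
    (fun i _ => h0 _ _) (Finset.mem_univ w)))

lemma infoRatio_pos (h0 : ∀ w c, 0 ≤ Q w c) {w : W} {c : C} (h : 0 < Q w c) :
    0 < infoRatio Q w c :=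
  div_pos h (outputDist_pos h0 h)

lemma sum_infoRatio_le (c : C) : ∑ w, infoRatio Q w c ≤ Fintype.card W := by
  simp only [infoRatio, ← Finset.sum_div]
  by_cases h : outputDist Q c = 0
  · simp [h]
  have hs : ∑ w, Q w c = Fintype.card W * outputDist Q c := by
    have hc : (Fintype.card W : ℝ) ≠ 0 := by
      intro hc; exact h (by simp [outputDist, hc])
    rw [outputDist, mul_inv_cancel_left₀ hc]
  rw [hs, mul_div_cancel_right₀ _ h]

lemma infoRatio_le_card (h0 : ∀ w c, 0 ≤ Q w c) (w : W) (c : C) :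
    infoRatio Q w c ≤ Fintype.card W :=
  (Finset.single_le_sum (f := fun w => infoRatio Q w c) (fun _ _ => infoRatio_nonneg h0 _ _)
    (Finset.mem_univ w)).trans (sum_infoRatio_le c)

/-- The joint distribution of a uniform input of `Q` and the corresponding output. -/
noncomputable def uniformJoint (Q : W → C → ℝ) (q : W × C) : ℝ :=
  (Fintype.card W : ℝ)⁻¹ * Q q.1 q.2

lemma uniformJoint_nonneg (h0 : ∀ w c, 0 ≤ Q w c) (q : W × C) : 0 ≤ uniformJoint Q q :=
  mul_nonneg (by positivity) (h0 _ _)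

variable [Fintype C]

/-- The expectation of `F` under the joint distribution of a uniform input of `Q` and the
corresponding output. -/
noncomputable def expect (Q : W → C → ℝ) (F : W → C → ℝ) : ℝ :=
  (Fintype.card W : ℝ)⁻¹ * ∑ w, ∑ c, Q w c * F w c

lemma sum_outputDist [Nonempty W] (h1 : ∀ w, ∑ c, Q w c = 1) : ∑ c, outputDist Q c = 1 := by
  have hc : (0 : ℝ) < Fintype.card W := by exact_mod_cast Fintype.card_pos
  simp only [outputDist, ← Finset.mul_sum]
  rw [Finset.sum_comm]
  simp only [h1, Finset.sum_const, Finset.card_univ, nsmul_eq_mul, mul_one]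
  exact inv_mul_cancel₀ hc.ne'

lemma expect_mono (h0 : ∀ w c, 0 ≤ Q w c) {F G : W → C → ℝ}
    (h : ∀ w c, 0 < Q w c → F w c ≤ G w c) : expect Q F ≤ expect Q G := by
  refine mul_le_mul_of_nonneg_left (Finset.sum_le_sum fun w _ => Finset.sum_le_sum fun c _ => ?_)
    (by positivity)
  rcases (h0 w c).eq_or_lt with h' | h'
  · simp [← h']
  · exact mul_le_mul_of_nonneg_left (h w c h') h'.le

lemma expect_add (F G : W → C → ℝ) :
    expect Q (fun w c => F w c + G w c) = expect Q F + expect Q G := by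
  simp only [expect, mul_add, Finset.sum_add_distrib]

lemma expect_sum {ι : Type*} [Fintype ι] (F : ι → W → C → ℝ) :
    expect Q (fun w c => ∑ j, F j w c) = ∑ j, expect Q (F j) := by
  simp only [expect]
  rw [← Finset.mul_sum, Finset.sum_comm (s := (Finset.univ : Finset ι))]
  refine congrArg _ (Finset.sum_congr rfl fun w _ => ?_)
  rw [Finset.sum_comm]
  simp only [Finset.mul_sum]

lemma expect_const [Nonempty W] (h1 : ∀ w, ∑ c, Q w c = 1) (a : ℝ) :
    expect Q (fun _ _ => a) = a := by
  have hc : (0 : ℝ) < Fintype.card W := by exact_mod_cast Fintype.card_pos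
  simp only [expect, ← Finset.sum_mul, h1, Finset.sum_const, Finset.card_univ, nsmul_eq_mul,
    mul_one]
  exact inv_mul_cancel_left₀ hc.ne' a

lemma sum_uniformJoint (h1 : ∀ w, ∑ c, Q w c = 1) (w : W) :
    ∑ c, uniformJoint Q (w, c) = (Fintype.card W : ℝ)⁻¹ := by
  simp only [uniformJoint, ← Finset.mul_sum, h1, mul_one]

lemma mutualInfo_uniformJoint (h1 : ∀ w, ∑ c, Q w c = 1) :
    mutualInfo (uniformJoint Q) = expect Q fun w c => Real.logb 2 (infoRatio Q w c) := by
  rw [mutualInfo, expect, Finset.mul_sum]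
  simp only [sum_uniformJoint h1]
  refine Finset.sum_congr rfl fun w _ => ?_
  rw [Finset.mul_sum]
  refine Finset.sum_congr rfl fun c _ => ?_
  have : Nonempty W := ⟨w⟩
  have hc : (0 : ℝ) < Fintype.card W := by exact_mod_cast Fintype.card_pos
  have : uniformJoint Q (w, c) / ((Fintype.card W : ℝ)⁻¹ * ∑ a', uniformJoint Q (a', c))
      = infoRatio Q w c := by
    rw [uniformJoint, mul_div_mul_left _ _ (by positivity), infoRatio, outputDist, Finset.mul_sum]
    rfl
  rw [this, uniformJoint, mul_assoc]

/-- `t (ln t)² ≤ 4 + t (ln M)²` for `0 ≤ t ≤ M`: for `t ≤ 1` because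
`-ln t = 2 ln (1 / √t) ≤ 2 (1 / √t - 1)`, for `t ≥ 1` by monotonicity. -/
lemma mul_log_sq_le {t M : ℝ} (ht : 0 ≤ t) (htM : t ≤ M) :
    t * Real.log t ^ 2 ≤ 4 + t * Real.log M ^ 2 := by
  rcases le_total t 1 with h | h
  · rcases ht.eq_or_lt with h0 | h0
    · simp [← h0]
    have hs : 0 < √t := Real.sqrt_pos.2 h0
    have h1 := Real.log_le_sub_one_of_pos (inv_pos.2 hs)
    rw [Real.log_inv, Real.log_sqrt ht] at h1
    have hl : Real.log t ≤ 0 := Real.log_nonpos ht h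
    have h2 : √t * (-Real.log t) ≤ 2 := by
      have := mul_le_mul_of_nonneg_left h1 hs.le
      rw [mul_sub, mul_inv_cancel₀ hs.ne'] at this
      nlinarith
    have h3 : 0 ≤ √t * (-Real.log t) := mul_nonneg hs.le (by linarith)
    have h4 : t * Real.log t ^ 2 = (√t * (-Real.log t)) ^ 2 := by
      rw [mul_pow, Real.sq_sqrt ht]; ring
    have : 0 ≤ t * Real.log M ^ 2 := by positivity
    rw [h4]; nlinarith
  · have h1 : 0 ≤ Real.log t := Real.log_nonneg h
    have h2 : Real.log t ≤ Real.log M := Real.log_le_log (by linarith) htM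
    have : t * Real.log t ^ 2 ≤ t * Real.log M ^ 2 := by gcongr
    linarith

/-- The second moment of the information density is at most of the order of `(log |W|)²`,
whatever the stochastic matrix is. -/
lemma expect_logb_infoRatio_sq_le [Nonempty W] (h0 : ∀ w c, 0 ≤ Q w c)
    (h1 : ∀ w, ∑ c, Q w c = 1) :
    expect Q (fun w c => Real.logb 2 (infoRatio Q w c) ^ 2)
      ≤ 4 / Real.log 2 ^ 2 + Real.logb 2 (Fintype.card W) ^ 2 := by
  have h2 : 0 < Real.log 2 := Real.log_pos one_lt_two
  have hc : (0 : ℝ) < Fintype.card W := by exact_mod_cast Fintype.card_pos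
  have key : ∀ w c, Q w c * Real.logb 2 (infoRatio Q w c) ^ 2
      ≤ outputDist Q c * (4 / Real.log 2 ^ 2) + Q w c * Real.logb 2 (Fintype.card W) ^ 2 := by
    intro w c
    have h := mul_log_sq_le (infoRatio_nonneg h0 w c) (infoRatio_le_card h0 w c)
    rcases (h0 w c).eq_or_lt with h' | h'
    · rw [← h', zero_mul, zero_mul, add_zero]
      exact mul_nonneg (outputDist_nonneg h0 c) (by positivity)
    have hQ : Q w c = outputDist Q c * infoRatio Q w c := by
      rw [infoRatio, mul_div_cancel₀ _ (outputDist_pos h0 h').ne']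
    have := div_le_div_of_nonneg_right (mul_le_mul_of_nonneg_left h (outputDist_nonneg h0 c))
      (sq_nonneg (Real.log 2))
    rw [Real.logb, Real.logb]
    calc Q w c * (Real.log (infoRatio Q w c) / Real.log 2) ^ 2
        = outputDist Q c * (infoRatio Q w c * Real.log (infoRatio Q w c) ^ 2) / Real.log 2 ^ 2 := by
          rw [hQ, div_pow]; ring
      _ ≤ _ := this
      _ = outputDist Q c * (4 / Real.log 2 ^ 2) + (outputDist Q c * infoRatio Q w c) *
          (Real.log (Fintype.card W) / Real.log 2) ^ 2 := by rw [div_pow]; ring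
      _ = _ := by rw [← hQ]
  have hle : ∑ w, ∑ c, Q w c * Real.logb 2 (infoRatio Q w c) ^ 2 ≤
      Fintype.card W * (4 / Real.log 2 ^ 2 + Real.logb 2 (Fintype.card W) ^ 2) := by
    refine (Finset.sum_le_sum fun w _ => Finset.sum_le_sum fun c _ => key w c).trans (le_of_eq ?_)
    simp only [Finset.sum_add_distrib, ← Finset.sum_mul, sum_outputDist h1, h1, Finset.sum_const,
      Finset.card_univ, nsmul_eq_mul]
    ring
  calc _ ≤ (Fintype.card W : ℝ)⁻¹ * (Fintype.card W * _) :=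
        mul_le_mul_of_nonneg_left hle (by positivity)
    _ = _ := inv_mul_cancel_left₀ hc.ne' _

end Density

/-! ### Averages over random permutations and soft covering -/

section Covering

variable {W : Type*} [Fintype W] [DecidableEq W]

/-- The image of a point under a uniformly random permutation is uniform. -/
lemma card_mul_sum_perm_apply (F : W → ℝ) (a : W) :
    Fintype.card W * ∑ σ : Equiv.Perm W, F (σ a) = Fintype.card (Equiv.Perm W) * ∑ w, F w := by
  have h : ∀ b, ∑ σ : Equiv.Perm W, F (σ b) = ∑ σ : Equiv.Perm W, F (σ a) := fun b =>
    Fintype.sum_equiv (Equiv.mulRight (Equiv.swap a b)) _ _ fun σ => by simp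
  calc (Fintype.card W : ℝ) * ∑ σ : Equiv.Perm W, F (σ a)
      = ∑ b, ∑ σ : Equiv.Perm W, F (σ b) := by simp [h]
    _ = ∑ σ : Equiv.Perm W, ∑ b, F (σ b) := Finset.sum_comm
    _ = _ := by simp [Equiv.sum_comp]

/-- Given the image of `a` under a uniformly random permutation, the image of `b ≠ a` is uniform
on the remaining points. -/
lemma card_sub_one_mul_sum_perm_apply_mul (h i : W → ℝ) {a b : W} (hab : b ≠ a) :
    ((Fintype.card W : ℝ) - 1) * ∑ σ : Equiv.Perm W, h (σ a) * i (σ b)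
      = ∑ σ : Equiv.Perm W, h (σ a) * (∑ w, i w - i (σ a)) := by
  have hsymm : ∀ c ∈ Finset.univ.erase a, ∑ σ : Equiv.Perm W, h (σ a) * i (σ c)
      = ∑ σ : Equiv.Perm W, h (σ a) * i (σ b) := fun c hc =>
    Fintype.sum_equiv (Equiv.mulRight (Equiv.swap b c)) _ _ fun σ => by
      simp [Equiv.swap_apply_of_ne_of_ne hab.symm (Finset.ne_of_mem_erase hc).symm]
  have hcard : ((Finset.univ.erase a).card : ℝ) = (Fintype.card W : ℝ) - 1 := by
    rw [Finset.card_erase_of_mem (Finset.mem_univ a), Finset.card_univ,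
      Nat.cast_sub (Fintype.card_pos_iff.2 ⟨a⟩), Nat.cast_one]
  have hsum : ∀ σ : Equiv.Perm W, ∑ w, i w - i (σ a) = ∑ c ∈ Finset.univ.erase a, i (σ c) := by
    intro σ
    rw [← Equiv.sum_comp σ i, ← Finset.add_sum_erase _ _ (Finset.mem_univ a)]
    ring
  calc _ = ∑ c ∈ Finset.univ.erase a, ∑ σ : Equiv.Perm W, h (σ a) * i (σ c) := by
        rw [Finset.sum_congr rfl hsymm, Finset.sum_const, nsmul_eq_mul, hcard]
    _ = _ := by
        rw [Finset.sum_comm]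
        simp only [hsum, Finset.mul_sum]

/-- Given that a uniformly random permutation maps one point of an injective family to `w`, the
mean over the family of a nonnegative function `i` of average at most one has conditional
expectation at most `1 + i w / |P|`; tested here against `h ≥ 0`. -/
lemma sum_perm_mul_mean_sub_le {P : Type*} [Fintype P] (g : P → W) (hg : Function.Injective g)
    (h i : W → ℝ) (hh : ∀ w, 0 ≤ h w) (hi : ∀ w, 0 ≤ i w) (hsum : ∑ w, i w ≤ Fintype.card W) :
    ∑ σ : Equiv.Perm W, ∑ p, h (σ (g p)) *
      ((∑ p', i (σ (g p'))) / Fintype.card P - (1 + i (σ (g p)) / Fintype.card P)) ≤ 0 := by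
  classical
  rw [Finset.sum_comm]
  refine Finset.sum_nonpos fun p _ => ?_
  have hP : (0 : ℝ) < Fintype.card P := by exact_mod_cast Fintype.card_pos_iff.2 ⟨p⟩
  have hPW : (Fintype.card P : ℝ) ≤ Fintype.card W := by
    exact_mod_cast Fintype.card_le_of_injective g hg
  set H := ∑ σ : Equiv.Perm W, h (σ (g p)) with hH
  have hH0 : 0 ≤ H := Finset.sum_nonneg fun _ _ => hh _
  have hcard : ((Finset.univ.erase p).card : ℝ) = (Fintype.card P : ℝ) - 1 := by
    rw [Finset.card_erase_of_mem (Finset.mem_univ p), Finset.card_univ,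
      Nat.cast_sub (Fintype.card_pos_iff.2 ⟨p⟩), Nat.cast_one]
  have hpair : ∀ p' ∈ Finset.univ.erase p,
      ((Fintype.card P : ℝ) - 1) * ∑ σ : Equiv.Perm W, h (σ (g p)) * i (σ (g p'))
        ≤ Fintype.card P * H := by
    intro p' hp'
    have hne : g p' ≠ g p := hg.ne (Finset.ne_of_mem_erase hp')
    have hP2 : (2 : ℝ) ≤ Fintype.card P := by
      have : Nontrivial P := ⟨p', p, Finset.ne_of_mem_erase hp'⟩
      exact_mod_cast Fintype.one_lt_card (α := P)
    have h1 := card_sub_one_mul_sum_perm_apply_mul h i hne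
    have h2 : ∑ σ : Equiv.Perm W, h (σ (g p)) * (∑ w, i w - i (σ (g p)))
        ≤ Fintype.card W * H := by
      rw [hH, Finset.mul_sum]
      refine Finset.sum_le_sum fun σ _ => ?_
      rw [mul_comm]
      exact mul_le_mul_of_nonneg_right (by linarith [hi (σ (g p))]) (hh _)
    rw [← h1] at h2
    have hW : (0 : ℝ) < Fintype.card W - 1 := by linarith
    refine le_of_mul_le_mul_left ?_ hW
    set B := ∑ σ : Equiv.Perm W, h (σ (g p)) * i (σ (g p'))
    have h3 := mul_le_mul_of_nonneg_left h2 (by linarith : (0 : ℝ) ≤ Fintype.card P - 1)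
    nlinarith [mul_nonneg (sub_nonneg.2 hPW) hH0]
  have htot : ∑ p' ∈ Finset.univ.erase p,
      ∑ σ : Equiv.Perm W, h (σ (g p)) * i (σ (g p')) ≤ Fintype.card P * H := by
    rcases (Finset.univ.erase p).eq_empty_or_nonempty with he | hne
    · rw [he, Finset.sum_empty]; positivity
    have hpos : (0 : ℝ) < (Fintype.card P : ℝ) - 1 := by
      rw [← hcard]; exact_mod_cast hne.card_pos
    refine le_of_mul_le_mul_left ?_ hpos
    rw [Finset.mul_sum]
    refine (Finset.sum_le_sum hpair).trans ?_
    rw [Finset.sum_const, nsmul_eq_mul, hcard]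
  calc ∑ σ : Equiv.Perm W, h (σ (g p)) *
      ((∑ p', i (σ (g p'))) / Fintype.card P - (1 + i (σ (g p)) / Fintype.card P))
      = ∑ σ : Equiv.Perm W, ((∑ p' ∈ Finset.univ.erase p, h (σ (g p)) * i (σ (g p')))
          / Fintype.card P - h (σ (g p))) := by
        refine Finset.sum_congr rfl fun σ _ => ?_
        rw [← Finset.add_sum_erase _ _ (Finset.mem_univ p), ← Finset.mul_sum]
        ring
    _ = (∑ p' ∈ Finset.univ.erase p, ∑ σ : Equiv.Perm W, h (σ (g p)) * i (σ (g p')))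
          / Fintype.card P - H := by
        rw [Finset.sum_sub_distrib, ← Finset.sum_div, Finset.sum_comm]
    _ ≤ 0 := by
        rw [sub_nonpos, div_le_iff₀ hP, mul_comm H]
        exact htot

variable {C : Type*} [Fintype C]

/-- Soft covering: if the inputs of `Q` are arranged at random into bins, labelled by `S`, of `|P|`
inputs each, then the mutual information between the label of the bin and the output is on average
at most `𝔼 log (1 + ratio / |P|)`; it is small once `log |P|` exceeds the information density. -/
lemma exists_perm_mutualInfo_le {P S : Type*} [Fintype P] [Fintype S] [Nonempty P] [Nonempty S]
    (Q : W → C → ℝ) (h0 : ∀ w c, 0 ≤ Q w c) (h1 : ∀ w, ∑ c, Q w c = 1)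
    (f : P × S → W) (hf : Function.Injective f) :
    ∃ σ : Equiv.Perm W,
      mutualInfo (fun q : S × C => ∑ p, uniformJoint (fun v => Q (σ (f v))) ((p, q.1), q.2))
        ≤ expect Q fun w c => Real.logb 2 (1 + infoRatio Q w c / Fintype.card P) := by
  have h2 : 0 < Real.log 2 := Real.log_pos one_lt_two
  have hP : (0 : ℝ) < Fintype.card P := by exact_mod_cast Fintype.card_pos
  have hS : (0 : ℝ) < Fintype.card S := by exact_mod_cast Fintype.card_pos
  have : Nonempty W := ⟨f (Classical.arbitrary _)⟩
  have hW : (0 : ℝ) < Fintype.card W := by exact_mod_cast Fintype.card_pos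
  have hPS : (Fintype.card (P × S) : ℝ) = Fintype.card P * Fintype.card S := by
    rw [Fintype.card_prod, Nat.cast_mul]
  set N : ℝ := (Fintype.card (P × S) : ℝ) with hN
  have hN0 : 0 < N := by rw [hPS]; positivity
  set F : C → W → ℝ := fun c w => Q w c * Real.logb 2 (1 + infoRatio Q w c / Fintype.card P)
    with hF
  set h : C → W → ℝ := fun c w => Q w c / (1 + infoRatio Q w c / Fintype.card P) with hh
  set G : C → S → Equiv.Perm W → P → ℝ := fun c s σ p => h c (σ (f (p, s))) *
      ((∑ p', infoRatio Q (σ (f (p', s))) c) / Fintype.card P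
        - (1 + infoRatio Q (σ (f (p, s))) c / Fintype.card P)) with hG
  have hden : ∀ w c, 0 < 1 + infoRatio Q w c / Fintype.card P := fun w c => by
    have := infoRatio_nonneg h0 w c
    positivity
  -- the bound for a fixed permutation, by comparison with the output distribution of `Q`
  have hfix : ∀ σ : Equiv.Perm W,
      mutualInfo (fun q : S × C => ∑ p, uniformJoint (fun v => Q (σ (f v))) ((p, q.1), q.2))
        ≤ ∑ s, ∑ c, N⁻¹ * ∑ p, (F c (σ (f (p, s))) + G c s σ p / Real.log 2) := by
    intro σ
    have hnn : ∀ q : S × C, 0 ≤ ∑ p, uniformJoint (fun v => Q (σ (f v))) ((p, q.1), q.2) :=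
      fun q => Finset.sum_nonneg fun p _ => uniformJoint_nonneg (fun _ _ => h0 _ _) _
    have hmarg : ∀ s, ∑ c, ∑ p, uniformJoint (fun v => Q (σ (f v))) ((p, s), c)
        = (Fintype.card S : ℝ)⁻¹ := by
      intro s
      rw [Finset.sum_comm]
      simp only [sum_uniformJoint (Q := fun v => Q (σ (f v))) (fun _ => h1 _), Finset.sum_const,
        Finset.card_univ, nsmul_eq_mul]
      rw [← hN, hPS]
      field_simp
    refine (mutualInfo_le_sum_logb _ hnn (outputDist Q) (outputDist_nonneg h0) ?_ ?_).trans ?_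
    · simp only [hmarg, sum_outputDist h1, Finset.sum_const, Finset.card_univ, nsmul_eq_mul]
      rw [mul_inv_cancel₀ hS.ne']
    · intro s c hc
      refine Finset.sum_eq_zero fun p _ => ?_
      have : Q (σ (f (p, s))) c = 0 := by
        by_contra hne
        exact (outputDist_pos h0 (lt_of_le_of_ne (h0 _ _) (Ne.symm hne))).ne' hc
      simp [uniformJoint, this]
    refine Finset.sum_le_sum fun s _ => Finset.sum_le_sum fun c _ => ?_
    simp only [hmarg]
    have hratio : (∑ p, uniformJoint (fun v => Q (σ (f v))) ((p, s), c))
        / ((Fintype.card S : ℝ)⁻¹ * outputDist Q c)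
        = (∑ p', infoRatio Q (σ (f (p', s))) c) / Fintype.card P := by
      simp only [uniformJoint, infoRatio, ← Finset.mul_sum, ← Finset.sum_div]
      rw [← hN, hPS]
      field_simp
    rw [hratio]
    simp only [uniformJoint, ← Finset.mul_sum]
    rw [mul_assoc, Finset.sum_mul, ← hN]
    refine mul_le_mul_of_nonneg_left (Finset.sum_le_sum fun p _ => ?_) (by positivity)
    rcases (h0 (σ (f (p, s))) c).eq_or_lt with hq | hq
    · simp [hF, hG, hh, ← hq]
    have hg : 0 < (∑ p', infoRatio Q (σ (f (p', s))) c) / Fintype.card P :=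
      div_pos ((infoRatio_pos h0 hq).trans_le
        (Finset.single_le_sum (f := fun p' => infoRatio Q (σ (f (p', s))) c)
          (fun _ _ => infoRatio_nonneg h0 _ _) (Finset.mem_univ p))) hP
    refine (mul_le_mul_of_nonneg_left (logb_two_le_logb_add hg (hden (σ (f (p, s))) c))
      hq.le).trans (le_of_eq ?_)
    have := (hden (σ (f (p, s))) c).ne'
    have hring : ∀ q L x A l : ℝ, A ≠ 0 →
        q * (L + (x / A - 1) / l) = q * L + q / A * (x - A) / l := by
      intro q L x A l hA
      rw [div_mul_eq_mul_div, mul_div_assoc q, sub_div x, div_self hA]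
      ring
    exact hring _ _ _ _ _ this
  -- the average over all permutations
  have hGsum : ∀ c s, ∑ σ, ∑ p, G c s σ p ≤ 0 := fun c s =>
    sum_perm_mul_mean_sub_le (fun p => f (p, s))
      (fun p p' hpp => (Prod.ext_iff.1 (hf hpp)).1) (h c) (fun w => infoRatio Q w c)
      (fun w => div_nonneg (h0 w c) (hden w c).le) (fun w => infoRatio_nonneg h0 w c)
      (sum_infoRatio_le c)
  have hFsum : ∀ c s p, ∑ σ : Equiv.Perm W, F c (σ (f (p, s)))
      = Fintype.card (Equiv.Perm W) * ((Fintype.card W : ℝ)⁻¹ * ∑ w, F c w) := fun c s p => by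
    have := card_mul_sum_perm_apply (F c) (f (p, s))
    field_simp
    linarith
  have havg : ∑ σ : Equiv.Perm W, mutualInfo
      (fun q : S × C => ∑ p, uniformJoint (fun v => Q (σ (f v))) ((p, q.1), q.2))
      ≤ ∑ _σ : Equiv.Perm W,
        expect Q fun w c => Real.logb 2 (1 + infoRatio Q w c / Fintype.card P) := by
    refine (Finset.sum_le_sum fun σ _ => hfix σ).trans ?_
    rw [Finset.sum_comm]
    calc _ ≤ ∑ _s : S, Fintype.card (Equiv.Perm W) * ((Fintype.card S : ℝ)⁻¹ *
          expect Q fun w c => Real.logb 2 (1 + infoRatio Q w c / Fintype.card P)) := by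
          refine Finset.sum_le_sum fun s _ => ?_
          rw [Finset.sum_comm, expect, Finset.sum_comm (s := (Finset.univ : Finset W))]
          simp only [Finset.mul_sum]
          refine Finset.sum_le_sum fun c _ => ?_
          have hs := hFsum c s
          have hg := hGsum c s
          simp only [← Finset.mul_sum]
          calc N⁻¹ * ∑ σ : Equiv.Perm W, ∑ p, (F c (σ (f (p, s))) + G c s σ p / Real.log 2)
              = N⁻¹ * (∑ p : P, ∑ σ : Equiv.Perm W, F c (σ (f (p, s)))
                + (∑ σ, ∑ p, G c s σ p) / Real.log 2) := by
                simp only [Finset.sum_add_distrib, ← Finset.sum_div]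
                rw [Finset.sum_comm]
            _ ≤ N⁻¹ * (∑ p : P, ∑ σ : Equiv.Perm W, F c (σ (f (p, s)))) := by
                refine mul_le_mul_of_nonneg_left ?_ (by positivity)
                have := div_nonpos_of_nonpos_of_nonneg hg h2.le
                linarith
            _ = _ := by
                simp only [hs, Finset.sum_const, Finset.card_univ, nsmul_eq_mul]
                change _ = _ * (_ * (_ * ∑ w, F c w))
                generalize ∑ w, F c w = T
                rw [hPS]
                field_simp
      _ = _ := by
          simp only [Finset.sum_const, Finset.card_univ, nsmul_eq_mul]
          field_simp
  obtain ⟨σ, -, hσ⟩ := Finset.exists_le_of_sum_le Finset.univ_nonempty havg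
  exact ⟨σ, hσ⟩

end Covering

/-! ### Products of stochastic matrices -/

section Product

variable {ι : Type*} [Fintype ι] [DecidableEq ι] {W C : ι → Type*} [∀ k, Fintype (W k)]
  [∀ k, Fintype (C k)] {D : Type*} [Fintype D]

/-- The product of the stochastic matrices `Q k`; the identification `e` of its output alphabet
with the product of the output alphabets of the factors is a parameter. -/
noncomputable def prodMatrix (Q : ∀ k, W k → C k → ℝ) (e : D ≃ ∀ k, C k) (w : ∀ k, W k) (d : D) :
    ℝ :=
  ∏ k, Q k (w k) (e d k)

lemma sum_sum_prod_eq (F : ∀ k, W k → C k → ℝ) (e : D ≃ ∀ k, C k) :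
    ∑ w : ∀ k, W k, ∑ d, ∏ k, F k (w k) (e d k) = ∏ k, ∑ a, ∑ b, F k a b := by
  rw [Fintype.prod_sum]
  refine Finset.sum_congr rfl fun w _ => ?_
  rw [Fintype.prod_sum]
  exact Fintype.sum_equiv e _ _ fun _ => rfl

variable {Q : ∀ k, W k → C k → ℝ} (e : D ≃ ∀ k, C k)

omit [DecidableEq ι] [∀ k, Fintype (W k)] [∀ k, Fintype (C k)] [Fintype D] in
lemma prodMatrix_nonneg (h0 : ∀ k w c, 0 ≤ Q k w c) (w : ∀ k, W k) (d : D) :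
    0 ≤ prodMatrix Q e w d :=
  Finset.prod_nonneg fun _ _ => h0 _ _ _

omit [∀ k, Fintype (W k)] in
lemma sum_prodMatrix (h1 : ∀ k w, ∑ c, Q k w c = 1) (w : ∀ k, W k) :
    ∑ d, prodMatrix Q e w d = 1 := by
  calc ∑ d, prodMatrix Q e w d = ∑ c : ∀ k, C k, ∏ k, Q k (w k) (c k) :=
        Fintype.sum_equiv e _ _ fun _ => rfl
    _ = ∏ k, ∑ c, Q k (w k) c := (Fintype.prod_sum _).symm
    _ = 1 := by simp [h1]

omit [∀ k, Fintype (C k)] [Fintype D] in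
lemma infoRatio_prodMatrix (w : ∀ k, W k) (d : D) :
    infoRatio (prodMatrix Q e) w d = ∏ k, infoRatio (Q k) (w k) (e d k) := by
  have : outputDist (prodMatrix Q e) d = ∏ k, outputDist (Q k) (e d k) := by
    simp only [outputDist, prodMatrix, Finset.prod_mul_distrib, Fintype.prod_sum,
      Fintype.card_pi, Nat.cast_prod, Finset.prod_inv_distrib]
  simp only [infoRatio, this, prodMatrix, Finset.prod_div_distrib]

/-- The coordinates are independent under the product. -/
lemma expect_prodMatrix_prod [∀ k, Nonempty (W k)] (h1 : ∀ k w, ∑ c, Q k w c = 1)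
    (G : ∀ k, W k → C k → ℝ) (s : Finset ι) :
    expect (prodMatrix Q e) (fun w d => ∏ k ∈ s, G k (w k) (e d k))
      = ∏ k ∈ s, expect (Q k) (G k) := by
  have hs : ∀ g : ι → ℝ, ∏ k ∈ s, g k = ∏ k, if k ∈ s then g k else 1 := fun g => by
    rw [Finset.prod_ite_mem, Finset.univ_inter]
  calc _ = ((Fintype.card (∀ k, W k) : ℕ) : ℝ)⁻¹ * ∑ w : ∀ k, W k, ∑ d,
        ∏ k, (Q k (w k) (e d k) * if k ∈ s then G k (w k) (e d k) else 1) := by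
        simp only [expect, prodMatrix, hs, Finset.prod_mul_distrib]
    _ = ∏ k, expect (Q k) (fun a b => if k ∈ s then G k a b else 1) := by
        rw [sum_sum_prod_eq (fun k a b => Q k a b * if k ∈ s then G k a b else 1) e]
        simp only [expect, Finset.prod_mul_distrib, Fintype.card_pi, Nat.cast_prod,
          Finset.prod_inv_distrib]
    _ = _ := by
        rw [hs]
        refine Finset.prod_congr rfl fun k _ => ?_
        split_ifs
        · rfl
        · exact expect_const (h1 k) 1

/-- The variance of a sum of independent centred random variables. -/
lemma expect_prodMatrix_sum_sq [∀ k, Nonempty (W k)] (h1 : ∀ k w, ∑ c, Q k w c = 1)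
    (G : ∀ k, W k → C k → ℝ) (hG : ∀ k, expect (Q k) (G k) = 0) :
    expect (prodMatrix Q e) (fun w d => (∑ k, G k (w k) (e d k)) ^ 2)
      = ∑ k, expect (Q k) (fun a b => G k a b ^ 2) := by
  simp only [sq, Finset.sum_mul_sum]
  rw [expect_sum]
  refine Finset.sum_congr rfl fun j _ => ?_
  rw [expect_sum]
  rw [Finset.sum_eq_single j]
  · have := expect_prodMatrix_prod e h1 (fun k a b => G k a b * G k a b) {j}
    simpa only [Finset.prod_singleton] using this
  · intro k _ hk
    have := expect_prodMatrix_prod e h1 G {j, k}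
    simp only [Finset.prod_pair hk.symm, hG, mul_zero] at this
    exact this
  · simp

lemma expect_abs_le {W C : Type*} [Fintype W] [Fintype C] [Nonempty W] {Q : W → C → ℝ}
    (h0 : ∀ w c, 0 ≤ Q w c) (h1 : ∀ w, ∑ c, Q w c = 1) (F : W → C → ℝ) {B : ℝ} (hB : 0 < B)
    (hF : expect Q (fun w c => F w c ^ 2) ≤ B ^ 2) : expect Q (fun w c => |F w c|) ≤ B := by
  have hle : expect Q (fun w c => |F w c|) ≤ expect Q (fun w c => F w c ^ 2 * (2 * B)⁻¹ + B / 2) := by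
    refine expect_mono h0 fun w c _ => ?_
    have : |F w c| * (2 * B) ≤ F w c ^ 2 + B ^ 2 := by
      nlinarith [sq_nonneg (|F w c| - B), sq_abs (F w c)]
    rw [← le_div_iff₀ (by positivity)] at this
    refine this.trans (le_of_eq ?_)
    field_simp
  refine hle.trans ?_
  rw [expect_add, expect_const h1]
  have : expect Q (fun w c => F w c ^ 2 * (2 * B)⁻¹)
      = expect Q (fun w c => F w c ^ 2) * (2 * B)⁻¹ := by
    simp only [expect, ← mul_assoc, ← Finset.sum_mul]
  rw [this]
  have : expect Q (fun w c => F w c ^ 2) * (2 * B)⁻¹ ≤ B ^ 2 * (2 * B)⁻¹ :=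
    mul_le_mul_of_nonneg_right hF (by positivity)
  have h : B ^ 2 * (2 * B)⁻¹ = B / 2 := by field_simp
  linarith

/-- The information density of a product is a sum of independent terms, hence it concentrates at
the sum of the mutual informations, up to the square root of the sum of the second moments. So
`L` inputs per bin suffice for soft covering as soon as `log L` exceeds that sum. -/
lemma expect_prodMatrix_logb_le [∀ k, Nonempty (W k)] (h0 : ∀ k w c, 0 ≤ Q k w c)
    (h1 : ∀ k w, ∑ c, Q k w c = 1) {L B : ℝ} (hL : 0 < L) (hB : 0 < B)
    (hV : ∑ k, expect (Q k) (fun w c => Real.logb 2 (infoRatio (Q k) w c) ^ 2) ≤ B ^ 2) :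
    expect (prodMatrix Q e) (fun w d => Real.logb 2 (1 + infoRatio (prodMatrix Q e) w d / L))
      ≤ 1 + max 0 (∑ k, mutualInfo (uniformJoint (Q k)) - Real.logb 2 L) + B := by
  set m : ι → ℝ := fun k => mutualInfo (uniformJoint (Q k)) with hm
  set G : ∀ k, W k → C k → ℝ := fun k a b => Real.logb 2 (infoRatio (Q k) a b) - m k with hG
  have hG0 : ∀ k, expect (Q k) (G k) = 0 := by
    intro k
    have : expect (Q k) (G k) = expect (Q k) (fun a b => Real.logb 2 (infoRatio (Q k) a b))
        + expect (Q k) (fun _ _ => - m k) := by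
      rw [← expect_add]; rfl
    rw [this, expect_const (h1 k), ← mutualInfo_uniformJoint (h1 k), add_neg_cancel]
  have hGV : ∀ k, expect (Q k) (fun a b => G k a b ^ 2)
      ≤ expect (Q k) (fun w c => Real.logb 2 (infoRatio (Q k) w c) ^ 2) := by
    intro k
    have h : expect (Q k) (fun w c => Real.logb 2 (infoRatio (Q k) w c) ^ 2)
        = expect (Q k) (fun a b => G k a b ^ 2) + (expect (Q k) (fun a b => 2 * m k * G k a b)
          + expect (Q k) (fun _ _ => m k ^ 2)) := by
      rw [← expect_add, ← expect_add]
      congr 1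
      funext a b
      simp only [hG]
      ring
    have h' : expect (Q k) (fun a b => 2 * m k * G k a b) = 2 * m k * expect (Q k) (G k) := by
      simp only [expect, mul_left_comm _ (2 * m k), ← Finset.mul_sum]
    rw [h, h', hG0, expect_const (h1 k)]
    nlinarith [sq_nonneg (m k)]
  have habs : expect (prodMatrix Q e) (fun w d => |∑ k, G k (w k) (e d k)|) ≤ B := by
    refine expect_abs_le (prodMatrix_nonneg e h0) (sum_prodMatrix e h1) _ hB ?_
    rw [expect_prodMatrix_sum_sq e h1 G hG0]
    exact (Finset.sum_le_sum fun k _ => hGV k).trans hV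
  have hmono := expect_mono (Q := prodMatrix Q e) (prodMatrix_nonneg e h0)
    (F := fun w d => Real.logb 2 (1 + infoRatio (prodMatrix Q e) w d / L))
    (G := fun w d => (1 + max 0 (∑ k, m k - Real.logb 2 L)) + |∑ k, G k (w k) (e d k)|) ?_
  · rw [expect_add, expect_const (sum_prodMatrix e h1)] at hmono
    linarith
  intro w d hQ
  set t := infoRatio (prodMatrix Q e) w d with ht
  have ht0 : 0 < t := infoRatio_pos (prodMatrix_nonneg e h0) hQ
  have hlog : Real.logb 2 t = ∑ k, G k (w k) (e d k) + ∑ k, m k := by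
    have hne : ∀ k ∈ Finset.univ, infoRatio (Q k) (w k) (e d k) ≠ 0 := by
      rw [ht, infoRatio_prodMatrix] at ht0
      exact Finset.prod_ne_zero_iff.1 ht0.ne'
    rw [ht, infoRatio_prodMatrix, Real.logb_prod _ _ hne]
    simp only [hG, Finset.sum_sub_distrib, sub_add_cancel]
  have hq : 0 < t / L := div_pos ht0 hL
  have h2 : Real.logb 2 (1 + t / L) ≤ 1 + max 0 (Real.logb 2 (t / L)) := by
    have hmax : 1 + t / L ≤ 2 * max 1 (t / L) := by
      linarith [le_max_left 1 (t / L), le_max_right 1 (t / L)]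
    have hm0 : 0 < max 1 (t / L) := lt_of_lt_of_le one_pos (le_max_left _ _)
    refine (Real.logb_le_logb_of_le one_lt_two (by positivity) hmax).trans ?_
    rw [Real.logb_mul two_ne_zero hm0.ne', Real.logb_self_eq_one one_lt_two]
    gcongr
    rcases max_choice 1 (t / L) with h | h <;> rw [h]
    · rw [Real.logb_one]; exact le_max_left _ _
    · exact le_max_right _ _
  refine h2.trans ?_
  rw [Real.logb_div ht0.ne' hL.ne', hlog, add_assoc]
  gcongr
  have h3 := le_abs_self (∑ k, G k (w k) (e d k))
  have h4 := abs_nonneg (∑ k, G k (w k) (e d k))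
  have h5 := le_max_left 0 (∑ k, m k - Real.logb 2 L)
  have h6 := le_max_right 0 (∑ k, m k - Real.logb 2 L)
  exact max_le (by linarith) (by linarith)

end Product

/-! ### Codes: restriction of the message set and concatenation -/

section Transition

variable {𝓦 X Y Z : Type*} [Fintype X] [Fintype Y] [Fintype Z] {n : ℕ}

/-- The conditional probability of the pair of output words given the message. -/
noncomputable def Code.transition (c : Code 𝓦 X Y n) (ch : Channel X Y Z)
    (w : 𝓦) (y : Fin n → Y) (z : Fin n → Z) : ℝ :=
  ∑ x : Fin n → X, (c.enc w).1 x * ∏ i, (ch (x i)).1 (y i, z i)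

/-- The stochastic matrix from the message to the eavesdropper's observation. -/
noncomputable def Code.eveMatrix (c : Code 𝓦 X Y n) (ch : Channel X Y Z)
    (w : 𝓦) (z : Fin n → Z) : ℝ :=
  ∑ y, c.transition ch w y z

variable (c : Code 𝓦 X Y n) (ch : Channel X Y Z)

lemma Code.transition_nonneg (w : 𝓦) (y : Fin n → Y) (z : Fin n → Z) :
    0 ≤ c.transition ch w y z :=
  Finset.sum_nonneg fun x _ => mul_nonneg ((c.enc w).2.1 x)
    (Finset.prod_nonneg fun i _ => (ch (x i)).2.1 _)

lemma Code.eveMatrix_nonneg (w : 𝓦) (z : Fin n → Z) : 0 ≤ c.eveMatrix ch w z :=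
  Finset.sum_nonneg fun _ _ => c.transition_nonneg ch _ _ _

lemma Code.sum_transition (w : 𝓦) : ∑ y, ∑ z, c.transition ch w y z = 1 := by
  have h : ∀ x : Fin n → X,
      ∑ y : Fin n → Y, ∑ z : Fin n → Z, ∏ i, (ch (x i)).1 (y i, z i) = 1 := by
    intro x
    have := sum_sum_prod_eq (fun i y z => (ch (x i)).1 (y, z)) (Equiv.refl (Fin n → Z))
    simp only [Equiv.refl_apply] at this
    rw [this]
    refine Finset.prod_eq_one fun i _ => ?_
    rw [← Fintype.sum_prod_type']
    exact (ch (x i)).2.2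
  calc ∑ y, ∑ z, c.transition ch w y z
      = ∑ x, (c.enc w).1 x * ∑ y : Fin n → Y, ∑ z : Fin n → Z, ∏ i, (ch (x i)).1 (y i, z i) := by
        simp only [transition, Finset.mul_sum]
        rw [Finset.sum_comm (s := (Finset.univ : Finset (Fin n → X)))]
        refine Finset.sum_congr rfl fun y _ => ?_
        rw [Finset.sum_comm]
    _ = 1 := by simp only [h, mul_one]; exact (c.enc w).2.2

lemma Code.sum_eveMatrix (w : 𝓦) : ∑ z, c.eveMatrix ch w z = 1 := by
  simp only [eveMatrix]
  rw [Finset.sum_comm, c.sum_transition ch w]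

variable [Fintype 𝓦]

lemma Code.joint_nonneg (w : 𝓦) (y : Fin n → Y) (z : Fin n → Z) : 0 ≤ c.joint ch w y z :=
  mul_nonneg (by positivity) (c.transition_nonneg ch w y z)

lemma Code.eavesdropper_eq : c.eavesdropper ch = uniformJoint (c.eveMatrix ch) := by
  funext q
  simp only [eavesdropper, uniformJoint, eveMatrix, Finset.mul_sum]
  rfl

lemma Code.equivocation_eq [Nonempty 𝓦] : c.equivocation ch
    = Real.logb 2 (Fintype.card 𝓦) - mutualInfo (uniformJoint (c.eveMatrix ch)) := by
  rw [equivocation, c.eavesdropper_eq]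
  exact condEntropy_eq_logb_card_sub _ (uniformJoint_nonneg (c.eveMatrix_nonneg ch))
    (sum_uniformJoint (c.sum_eveMatrix ch))

lemma Code.equivocation_le [Nonempty 𝓦] :
    c.equivocation ch ≤ Real.logb 2 (Fintype.card 𝓦) := by
  have hc : (0 : ℝ) < Fintype.card 𝓦 := by exact_mod_cast Fintype.card_pos
  have h : 0 ≤ mutualInfo (uniformJoint (c.eveMatrix ch)) := by
    refine mutualInfo_nonneg _ (uniformJoint_nonneg (c.eveMatrix_nonneg ch)) ?_
    simp only [sum_uniformJoint (c.sum_eveMatrix ch), Finset.sum_const, Finset.card_univ,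
      nsmul_eq_mul]
    exact mul_inv_cancel₀ hc.ne'
  rw [c.equivocation_eq ch]
  linarith

lemma Code.errorProb_nonneg [DecidableEq 𝓦] : 0 ≤ c.errorProb ch :=
  Finset.sum_nonneg fun w _ => Finset.sum_nonneg fun y _ => Finset.sum_nonneg fun z _ => by
    split_ifs
    · exact le_rfl
    · exact c.joint_nonneg ch w y z

/-- The probability of correct decoding. -/
lemma Code.one_sub_errorProb [DecidableEq 𝓦] [Nonempty 𝓦] : 1 - c.errorProb ch
    = ∑ w, ∑ y, ∑ z, if c.dec y = w then c.joint ch w y z else 0 := by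
  have hc : (0 : ℝ) < Fintype.card 𝓦 := by exact_mod_cast Fintype.card_pos
  have h : ∑ w, ∑ y, ∑ z, c.joint ch w y z = 1 := by
    have : ∀ w, ∑ y, ∑ z, c.joint ch w y z = (Fintype.card 𝓦 : ℝ)⁻¹ := by
      intro w
      have h : ∀ y z, c.joint ch w y z = (Fintype.card 𝓦 : ℝ)⁻¹ * c.transition ch w y z :=
        fun _ _ => rfl
      simp only [h, ← Finset.mul_sum, c.sum_transition, mul_one]
    simp only [this, Finset.sum_const, Finset.card_univ, nsmul_eq_mul]
    exact mul_inv_cancel₀ hc.ne'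
  rw [sub_eq_iff_eq_add, ← h, errorProb]
  simp only [← Finset.sum_add_distrib]
  refine Finset.sum_congr rfl fun w _ => Finset.sum_congr rfl fun y _ =>
    Finset.sum_congr rfl fun z _ => ?_
  split_ifs <;> simp

lemma Code.errorProb_le_one [DecidableEq 𝓦] [Nonempty 𝓦] : c.errorProb ch ≤ 1 := by
  have : 0 ≤ 1 - c.errorProb ch := by
    rw [c.one_sub_errorProb ch]
    refine Finset.sum_nonneg fun w _ => Finset.sum_nonneg fun y _ => Finset.sum_nonneg fun z _ => ?_
    split_ifs
    · exact c.joint_nonneg ch w y z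
    · exact le_rfl
  linarith

end Transition

section Restrict

variable {𝓦 𝓥 X Y Z : Type*} [Nonempty 𝓥] [Fintype X] [Fintype Y] [Fintype Z] {n : ℕ}

/-- The code which sends only the messages of `c` in the range of `f`; the decoder maps messages
outside the range to an arbitrary value. -/
noncomputable def Code.restrict (c : Code 𝓦 X Y n) (f : 𝓥 → 𝓦) : Code 𝓥 X Y n where
  enc v := c.enc (f v)
  dec y := Function.invFun f (c.dec y)

lemma Code.eveMatrix_restrict (c : Code 𝓦 X Y n) (ch : Channel X Y Z) (f : 𝓥 → 𝓦) :
    (c.restrict f).eveMatrix ch = fun v => c.eveMatrix ch (f v) :=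
  rfl

lemma Code.errorProb_restrict_le [Fintype 𝓦] [Fintype 𝓥] [DecidableEq 𝓦] [DecidableEq 𝓥]
    [Nonempty 𝓦] (c : Code 𝓦 X Y n) (ch : Channel X Y Z) {f : 𝓥 → 𝓦}
    (hf : Function.Injective f) :
    (c.restrict f).errorProb ch ≤ Fintype.card 𝓦 / Fintype.card 𝓥 * c.errorProb ch := by
  have hW : (0 : ℝ) < Fintype.card 𝓦 := by exact_mod_cast Fintype.card_pos
  have hV : (0 : ℝ) < Fintype.card 𝓥 := by exact_mod_cast Fintype.card_pos
  set g : 𝓦 → ℝ := fun w => ∑ y, ∑ z, if c.dec y = w then 0 else c.transition ch w y z with hg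
  have hg0 : ∀ w, 0 ≤ g w := fun w => Finset.sum_nonneg fun y _ => Finset.sum_nonneg fun z _ => by
    split_ifs
    · exact le_rfl
    · exact c.transition_nonneg ch w y z
  have hc : c.errorProb ch = (Fintype.card 𝓦 : ℝ)⁻¹ * ∑ w, g w := by
    simp only [errorProb, hg, Finset.mul_sum, mul_ite, mul_zero]
    rfl
  have hr : (c.restrict f).errorProb ch ≤ (Fintype.card 𝓥 : ℝ)⁻¹ * ∑ v, g (f v) := by
    simp only [errorProb, hg, Finset.mul_sum, mul_ite, mul_zero]
    refine Finset.sum_le_sum fun v _ => Finset.sum_le_sum fun y _ => Finset.sum_le_sum fun z _ => ?_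
    by_cases h : c.dec y = f v
    · have h' : (c.restrict f).dec y = v := by
        change Function.invFun f (c.dec y) = v
        rw [h, Function.leftInverse_invFun hf]
      rw [if_pos h, if_pos h']
    · rw [if_neg h]
      split_ifs
      · exact mul_nonneg (by positivity) (c.transition_nonneg ch _ _ _)
      · exact le_rfl
  have hsum : ∑ v, g (f v) ≤ ∑ w, g w := by
    rw [← Finset.sum_image (s := Finset.univ) (g := f) (f := g) (fun a _ b _ h => hf h)]
    exact Finset.sum_le_univ_sum_of_nonneg hg0
  calc _ ≤ (Fintype.card 𝓥 : ℝ)⁻¹ * ∑ w, g w :=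
        hr.trans (mul_le_mul_of_nonneg_left hsum (by positivity))
    _ = _ := by rw [hc]; field_simp

end Restrict

section Concat

variable {ι : Type*} [Fintype ι] {X Y Z : Type*} [Fintype X] [Fintype Y] [Fintype Z]
  {n : ι → ℕ} {N : ℕ}

/-- Splitting a word of length `N` into blocks of lengths `n k`, according to a partition `e` of
its positions. -/
def blockEquiv (A : Type*) (e : (Σ k, Fin (n k)) ≃ Fin N) : (Fin N → A) ≃ ∀ k, Fin (n k) → A :=
  (Equiv.arrowCongr e.symm (Equiv.refl A)).trans (Equiv.piCurry fun _ _ => A)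

omit [Fintype X] [Fintype Y] [Fintype Z] in
lemma prod_eq_prod_block (e : (Σ k, Fin (n k)) ≃ Fin N) (f : X → Y → Z → ℝ) (x : Fin N → X)
    (y : Fin N → Y) (z : Fin N → Z) :
    ∏ j, f (x j) (y j) (z j) = ∏ k, ∏ i, f (blockEquiv X e x k i) (blockEquiv Y e y k i)
      (blockEquiv Z e z k i) := by
  rw [← Equiv.prod_comp e, Fintype.prod_sigma]
  rfl

variable [DecidableEq ι] {𝓦 : ι → Type*}

/-- The concatenation of codes: independent messages are sent in disjoint blocks of channel
uses. -/
noncomputable def Code.concat (c : ∀ k, Code (𝓦 k) X Y (n k)) (e : (Σ k, Fin (n k)) ≃ Fin N) :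
    Code (∀ k, 𝓦 k) X Y N where
  enc w := ⟨fun x => ∏ k, ((c k).enc (w k)).1 (blockEquiv X e x k),
    fun x => Finset.prod_nonneg fun k _ => ((c k).enc (w k)).2.1 _, by
      rw [Fintype.sum_equiv (blockEquiv X e) _
        (fun x => ∏ k, ((c k).enc (w k)).1 (x k)) fun _ => rfl, ← Fintype.prod_sum]
      exact Finset.prod_eq_one fun k _ => ((c k).enc (w k)).2.2⟩
  dec y k := (c k).dec (blockEquiv Y e y k)

variable (c : ∀ k, Code (𝓦 k) X Y (n k)) (e : (Σ k, Fin (n k)) ≃ Fin N) (ch : Channel X Y Z)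

lemma Code.transition_concat (w : ∀ k, 𝓦 k) (y : Fin N → Y) (z : Fin N → Z) :
    (Code.concat c e).transition ch w y z
      = ∏ k, (c k).transition ch (w k) (blockEquiv Y e y k) (blockEquiv Z e z k) := by
  simp only [transition, Fintype.prod_sum]
  refine Fintype.sum_equiv (blockEquiv X e) _ _ fun x => ?_
  rw [Finset.prod_mul_distrib, prod_eq_prod_block e (fun x y z => (ch x).1 (y, z))]
  rfl

lemma Code.eveMatrix_concat : (Code.concat c e).eveMatrix ch
    = prodMatrix (fun k => (c k).eveMatrix ch) (blockEquiv Z e) := by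
  funext w z
  simp only [prodMatrix, eveMatrix, Fintype.prod_sum, Code.transition_concat]
  exact Fintype.sum_equiv (blockEquiv Y e) _ _ fun _ => rfl

lemma one_sub_sum_le_prod_one_sub {ι : Type*} (s : Finset ι) (a : ι → ℝ) (h0 : ∀ k, 0 ≤ a k)
    (h1 : ∀ k, a k ≤ 1) : 1 - ∑ k ∈ s, a k ≤ ∏ k ∈ s, (1 - a k) := by
  classical
  induction s using Finset.induction_on with
  | empty => simp
  | insert k s hk ih =>
    rw [Finset.sum_insert hk, Finset.prod_insert hk]
    have hs : 0 ≤ ∑ k ∈ s, a k := Finset.sum_nonneg fun _ _ => h0 _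
    nlinarith [mul_le_mul_of_nonneg_left ih (sub_nonneg.2 (h1 k)), mul_nonneg (h0 k) hs]

/-- The union bound for the concatenation of codes. -/
lemma Code.errorProb_concat_le [∀ k, Fintype (𝓦 k)] [∀ k, DecidableEq (𝓦 k)]
    [∀ k, Nonempty (𝓦 k)] :
    (Code.concat c e).errorProb ch ≤ ∑ k, (c k).errorProb ch := by
  have h : 1 - (Code.concat c e).errorProb ch = ∏ k, (1 - (c k).errorProb ch) := by
    simp only [Code.one_sub_errorProb]
    rw [← sum_sum_prod_eq (fun k w y => ∑ z, if (c k).dec y = w then (c k).joint ch w y z else 0)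
      (blockEquiv Y e)]
    refine Finset.sum_congr rfl fun w _ => Finset.sum_congr rfl fun y _ => ?_
    rw [Fintype.prod_sum]
    refine Fintype.sum_equiv (blockEquiv Z e) _ _ fun z => ?_
    have hj : (Code.concat c e).joint ch w y z
        = ∏ k, (c k).joint ch (w k) (blockEquiv Y e y k) (blockEquiv Z e z k) := by
      have := Code.transition_concat c e ch w y z
      simp only [joint, transition] at this ⊢
      rw [this, Finset.prod_mul_distrib, Finset.prod_inv_distrib, Fintype.card_pi, Nat.cast_prod]
    by_cases hd : (Code.concat c e).dec y = w
    · rw [if_pos hd, hj]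
      refine Finset.prod_congr rfl fun k _ => ?_
      exact (if_pos (congrFun hd k)).symm
    · rw [if_neg hd]
      obtain ⟨k, hk⟩ := Function.ne_iff.1 hd
      exact (Finset.prod_eq_zero (Finset.mem_univ k) (if_neg hk)).symm
  have := one_sub_sum_le_prod_one_sub Finset.univ (fun k => (c k).errorProb ch)
    (fun k => (c k).errorProb_nonneg ch) fun k => (c k).errorProb_le_one ch
  linarith

end Concat

/-! ### From equivocation to confidential messages -/

section Forward

variable {X Y Z : Type*} [Fintype X] [Fintype Y] [Fintype Z]

/-- Soft covering for a concatenation of codes: its messages can be grouped into confidential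
classes, labelled by `S`, of `|P|` messages each, whose leakage is controlled by the excess of the
mutual informations of the factors over `log |P|`. -/
lemma exists_code_of_concat {ι : Type*} [Fintype ι] [DecidableEq ι] {n : ι → ℕ} {N : ℕ}
    {𝓦 : ι → Type*} [∀ k, Fintype (𝓦 k)] [∀ k, DecidableEq (𝓦 k)] [∀ k, Nonempty (𝓦 k)]
    {P S : Type*} [Fintype P] [Fintype S] [Nonempty P] [Nonempty S] [DecidableEq P] [DecidableEq S]
    (ch : Channel X Y Z) (c : ∀ k, Code (𝓦 k) X Y (n k)) (e : (Σ k, Fin (n k)) ≃ Fin N)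
    (hle : Fintype.card (P × S) ≤ Fintype.card (∀ k, 𝓦 k))
    (hge : Fintype.card (∀ k, 𝓦 k) ≤ 2 * Fintype.card (P × S)) {B : ℝ} (hB : 0 < B)
    (hV : ∑ k, (4 / Real.log 2 ^ 2 + Real.logb 2 (Fintype.card (𝓦 k)) ^ 2) ≤ B ^ 2) :
    ∃ c' : Code (P × S) X Y N, c'.errorProb ch ≤ 2 * ∑ k, (c k).errorProb ch ∧
      c'.leakage ch ≤ 1 + max 0 (∑ k, (Real.logb 2 (Fintype.card (𝓦 k)) - (c k).equivocation ch)
        - Real.logb 2 (Fintype.card P)) + B := by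
  obtain ⟨f⟩ := Function.Embedding.nonempty_of_card_le hle
  have h0 : ∀ w z, 0 ≤ (Code.concat c e).eveMatrix ch w z := Code.eveMatrix_nonneg _ ch
  have h1 : ∀ w, ∑ z, (Code.concat c e).eveMatrix ch w z = 1 := Code.sum_eveMatrix _ ch
  obtain ⟨σ, hσ⟩ := exists_perm_mutualInfo_le ((Code.concat c e).eveMatrix ch) h0 h1 f f.injective
  have hP : (0 : ℝ) < Fintype.card P := by exact_mod_cast Fintype.card_pos
  have hPS : (0 : ℝ) < Fintype.card (P × S) := by exact_mod_cast Fintype.card_pos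
  refine ⟨(Code.concat c e).restrict fun v => σ (f v), ?_, ?_⟩
  · refine (Code.errorProb_restrict_le _ ch (σ.injective.comp f.injective)).trans ?_
    refine mul_le_mul ?_ (Code.errorProb_concat_le c e ch) (Code.errorProb_nonneg _ ch) two_pos.le
    rw [div_le_iff₀ hPS]
    exact_mod_cast hge
  · rw [Code.leakage, Code.eavesdropper_eq, Code.eveMatrix_restrict]
    refine hσ.trans ?_
    rw [Code.eveMatrix_concat]
    have hI : ∀ k, Real.logb 2 (Fintype.card (𝓦 k)) - (c k).equivocation ch
        = mutualInfo (uniformJoint ((c k).eveMatrix ch)) := fun k => by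
      rw [Code.equivocation_eq, sub_sub_cancel]
    simp only [hI]
    refine expect_prodMatrix_logb_le _ (fun k => (c k).eveMatrix_nonneg ch)
      (fun k => (c k).sum_eveMatrix ch) hP hB ((Finset.sum_le_sum fun k _ => ?_).trans hV)
    exact expect_logb_infoRatio_sq_le ((c k).eveMatrix_nonneg ch) ((c k).sum_eveMatrix ch)

/-- A set of `T` elements contains a rectangle `P × S` with at least half of the elements and with
`log S` close to a given value. -/
lemma exists_mul_le_and_logb {T : ℕ} (hT : 0 < T) {a : ℝ} (ha : 0 ≤ a) :
    ∃ P S : ℕ, 0 < P ∧ 0 < S ∧ P * S ≤ T ∧ T ≤ 2 * (P * S) ∧ Real.logb 2 S ≤ a ∧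
      min a (Real.logb 2 T) - 1 ≤ Real.logb 2 S ∧
      Real.logb 2 T - Real.logb 2 S - 1 ≤ Real.logb 2 P ∧
      Real.logb 2 P ≤ Real.logb 2 T - Real.logb 2 S := by
  have hT0 : (0 : ℝ) < T := by exact_mod_cast hT
  have hlT : 0 ≤ Real.logb 2 T := Real.logb_nonneg one_lt_two (by exact_mod_cast hT)
  set u : ℝ := 2 ^ min a (Real.logb 2 T) with hu
  have hu1 : 1 ≤ u := Real.one_le_rpow one_le_two (le_min ha hlT)
  have hu0 : 0 < u := by linarith
  have hlu : Real.logb 2 u = min a (Real.logb 2 T) := Real.logb_rpow two_pos (by norm_num)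
  have huT : u ≤ T := by
    calc u ≤ 2 ^ Real.logb 2 (T : ℝ) :=
          Real.rpow_le_rpow_of_exponent_le one_le_two (min_le_right _ _)
      _ = T := Real.rpow_logb two_pos (by norm_num) hT0
  set S := ⌊u⌋₊ with hS
  have hS0 : 0 < S := Nat.floor_pos.2 hu1
  have hSu : (S : ℝ) ≤ u := Nat.floor_le hu0.le
  have huS : u ≤ 2 * S := by
    have h1 := (Nat.lt_floor_add_one u).le
    have h2 : (1 : ℝ) ≤ S := by exact_mod_cast hS0
    rw [← hS] at h1
    linarith
  have hST : S ≤ T := by exact_mod_cast hSu.trans huT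
  have hP0 : 0 < T / S := Nat.div_pos hST hS0
  have hmul : T / S * S ≤ T := Nat.div_mul_le_self T S
  have hmul2 : T ≤ 2 * (T / S * S) := by
    have h1 := Nat.div_add_mod T S
    have h2 := Nat.mod_lt T hS0
    have h3 : S ≤ T / S * S := Nat.le_mul_of_pos_left S hP0
    rw [mul_comm] at h1
    omega
  have hSr : (0 : ℝ) < S := by exact_mod_cast hS0
  have hPr : (0 : ℝ) < (T / S : ℕ) := by exact_mod_cast hP0
  refine ⟨T / S, S, hP0, hS0, hmul, hmul2, ?_, ?_, ?_, ?_⟩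
  · calc Real.logb 2 S ≤ Real.logb 2 u := Real.logb_le_logb_of_le one_lt_two hSr hSu
      _ ≤ a := hlu ▸ min_le_left _ _
  · have := Real.logb_le_logb_of_le one_lt_two hu0 huS
    rw [Real.logb_mul two_ne_zero hSr.ne', Real.logb_self_eq_one one_lt_two, hlu] at this
    linarith
  · have h : (T : ℝ) ≤ 2 * ((T / S : ℕ) * S) := by exact_mod_cast hmul2
    have := Real.logb_le_logb_of_le one_lt_two hT0 h
    rw [Real.logb_mul two_ne_zero (by positivity), Real.logb_mul hPr.ne' hSr.ne',
      Real.logb_self_eq_one one_lt_two] at this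
    linarith
  · have h : ((T / S : ℕ) : ℝ) * S ≤ T := by exact_mod_cast hmul
    have := Real.logb_le_logb_of_le one_lt_two (by positivity) h
    rw [Real.logb_mul hPr.ne' hSr.ne'] at this
    linarith

/-- Lengths of `K` almost equal blocks which partition a word of length `N`. -/
lemma exists_block_lengths {K N : ℕ} (hK : 0 < K) :
    ∃ n : Fin K → ℕ, ∑ k, n k = N ∧ ∀ k, N / K ≤ n k ∧ n k ≤ N / K + 1 := by
  refine ⟨fun k => N / K + if (k : ℕ) < N % K then 1 else 0, ?_, fun k => ?_⟩
  · rw [Finset.sum_add_distrib, Finset.sum_const, Finset.card_univ, Fintype.card_fin,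
      Fin.sum_univ_eq_sum_range (fun k => if k < N % K then 1 else 0), ← Finset.card_filter,
      smul_eq_mul]
    have : Finset.filter (fun k => k < N % K) (Finset.range K) = Finset.range (N % K) := by
      ext k
      simp only [Finset.mem_filter, Finset.mem_range]
      have := Nat.mod_lt N hK
      omega
    rw [this, Finset.card_range]
    exact Nat.div_add_mod N K
  · dsimp only
    split_ifs <;> omega

/-- Good rate-equivocation codes can be turned into good private-confidential codes up to any
prescribed accuracy: `K` codes are concatenated, where `K` depends only on the accuracy, and
`exists_code_of_concat` is applied. -/
lemma eventually_exists_code (ch : Channel X Y Z) {Rp Re : ℝ} (hRp : 0 ≤ Rp) (hRe : 0 ≤ Re)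
    {M : ℕ → ℕ} {c : ∀ n, Code (Fin (M n)) X Y n} (hM : ∀ n, 0 < M n)
    (hrate : Tendsto (fun n : ℕ => Real.logb 2 (M n) / n) atTop (𝓝 (Rp + Re)))
    (herr : Tendsto (fun n => (c n).errorProb ch) atTop (𝓝 0))
    (hequiv : ∀ ε : ℝ, 0 < ε → ∀ᶠ n : ℕ in atTop, Re - ε ≤ (c n).equivocation ch / n)
    {ε : ℝ} (hε : 0 < ε) :
    ∀ᶠ N : ℕ in atTop, ∃ (P S : ℕ) (_ : 0 < P) (_ : 0 < S) (c' : Code (Fin P × Fin S) X Y N),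
      |Real.logb 2 P / N - Rp| ≤ ε ∧ |Real.logb 2 S / N - Re| ≤ ε ∧ c'.errorProb ch ≤ ε ∧
      c'.leakage ch / N ≤ ε := by
  set δ : ℝ := min (ε / 16) 1 with hδ
  have hδ0 : 0 < δ := lt_min (by positivity) one_pos
  have hδ1 : δ ≤ 1 := min_le_right _ _
  have hδε : δ ≤ ε / 16 := min_le_left _ _
  set A : ℝ := 4 / Real.log 2 ^ 2 + (Rp + Re + 1) ^ 2 with hA
  have hA0 : 0 ≤ A := by positivity
  -- with `K` blocks the standard deviation of the information density is at most `N * ε / 4`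
  obtain ⟨K, hK⟩ := exists_nat_gt (64 * A / ε ^ 2)
  have hKr : (0 : ℝ) < K := lt_of_le_of_lt (by positivity) hK
  have hK0 : 0 < K := by exact_mod_cast hKr
  rw [div_lt_iff₀ (by positivity)] at hK
  obtain ⟨m, hm⟩ := eventually_atTop.1 (((hrate.eventually (Metric.closedBall_mem_nhds _ hδ0)).and
    ((herr.eventually (ge_mem_nhds (show (0 : ℝ) < ε / (2 * K) by positivity))).and
      (hequiv δ hδ0))).and (eventually_ge_atTop 1))
  filter_upwards [eventually_ge_atTop (K * m), eventually_ge_atTop K,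
    (tendsto_natCast_atTop_atTop (R := ℝ)).eventually_ge_atTop (1 / δ)] with N hN1 hNK hN2
  rw [div_le_iff₀ hδ0] at hN2
  have hN0 : (0 : ℝ) < N := by exact_mod_cast lt_of_lt_of_le hK0 hNK
  have hδN : δ * N ≤ ε / 16 * N := mul_le_mul_of_nonneg_right hδε hN0.le
  have hεN : 0 < ε * N := mul_pos hε hN0
  obtain ⟨n, hnsum, hn⟩ := exists_block_lengths (N := N) hK0
  have hnm : ∀ k, m ≤ n k := fun k =>
    ((Nat.le_div_iff_mul_le hK0).2 (by rwa [mul_comm])).trans (hn k).1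
  have hn1 : ∀ k, (1 : ℝ) ≤ n k := fun k => by exact_mod_cast (hm _ (hnm k)).2
  have hnsumr : ∑ k, (n k : ℝ) = N := by exact_mod_cast hnsum
  have hnle : ∀ k, (n k : ℝ) * K ≤ 2 * N := fun k => by
    have h1 : 1 ≤ N / K := (Nat.le_div_iff_mul_le hK0).2 (by simpa using hNK)
    have h2 : n k * K ≤ 2 * N := by
      calc n k * K ≤ 2 * (N / K) * K := Nat.mul_le_mul_right _ (by have := (hn k).2; omega)
        _ = 2 * (N / K * K) := by ring
        _ ≤ 2 * N := Nat.mul_le_mul_left _ (Nat.div_mul_le_self N K)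
    exact_mod_cast h2
  have hlog : ∀ k, (Rp + Re - δ) * n k ≤ Real.logb 2 (M (n k)) ∧
      Real.logb 2 (M (n k)) ≤ (Rp + Re + δ) * n k := fun k => by
    have h := (hm _ (hnm k)).1.1
    have h0 : (0 : ℝ) < n k := by linarith [hn1 k]
    rwa [← Metric.mem_closedBall, Real.closedBall_eq_Icc, Set.mem_Icc, le_div_iff₀ h0,
      div_le_iff₀ h0] at h
  have hlog0 : ∀ k, 0 ≤ Real.logb 2 (M (n k)) := fun k =>
    Real.logb_nonneg one_lt_two (by exact_mod_cast hM (n k))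
  have heq : ∀ k, (Re - δ) * n k ≤ (c (n k)).equivocation ch := fun k => by
    have h := (hm _ (hnm k)).1.2.2
    have h0 : (0 : ℝ) < n k := by linarith [hn1 k]
    rwa [le_div_iff₀ h0] at h
  have : ∀ k, Nonempty (Fin (M (n k))) := fun k => ⟨⟨0, hM _⟩⟩
  have hcard : Fintype.card (∀ k, Fin (M (n k))) = ∏ k, M (n k) := by simp
  have hT : 0 < ∏ k, M (n k) := Finset.prod_pos fun k _ => hM _
  have hlT : Real.logb 2 ((∏ k, M (n k) : ℕ) : ℝ) = ∑ k, Real.logb 2 (M (n k)) := by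
    rw [Nat.cast_prod, Real.logb_prod]
    exact fun k _ => by exact_mod_cast (hM _).ne'
  have hlT1 : (Rp + Re - δ) * N ≤ Real.logb 2 ((∏ k, M (n k) : ℕ) : ℝ) := by
    rw [hlT, ← hnsumr, Finset.mul_sum]
    exact Finset.sum_le_sum fun k _ => (hlog k).1
  have hlT2 : Real.logb 2 ((∏ k, M (n k) : ℕ) : ℝ) ≤ (Rp + Re + δ) * N := by
    rw [hlT, ← hnsumr, Finset.mul_sum]
    exact Finset.sum_le_sum fun k _ => (hlog k).2
  obtain ⟨P, S, hP, hS, hle, hge, hS1, hS2, hP1, hP2⟩ :=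
    exists_mul_le_and_logb hT (mul_nonneg hN0.le hRe)
  have : Nonempty (Fin P) := ⟨⟨0, hP⟩⟩
  have : Nonempty (Fin S) := ⟨⟨0, hS⟩⟩
  have hmin : N * (Re - δ) ≤ min (N * Re) (Real.logb 2 ((∏ k, M (n k) : ℕ) : ℝ)) := by
    refine le_min (by linarith) (le_trans ?_ hlT1)
    linarith [mul_nonneg hRp hN0.le]
  have hV : ∑ k, (4 / Real.log 2 ^ 2 + Real.logb 2 (Fintype.card (Fin (M (n k)))) ^ 2)
      ≤ (N * ε / 4) ^ 2 := by
    have hk : ∀ k, 4 / Real.log 2 ^ 2 + Real.logb 2 (Fintype.card (Fin (M (n k)))) ^ 2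
        ≤ A * (2 * N / K) ^ 2 := by
      intro k
      have h1 : (n k : ℝ) ≤ 2 * N / K := (le_div_iff₀ hKr).2 (hnle k)
      have h2 : Real.logb 2 (M (n k)) ≤ (Rp + Re + 1) * n k :=
        (hlog k).2.trans (mul_le_mul_of_nonneg_right (by linarith) (by linarith [hn1 k]))
      have h3 : (1 : ℝ) ≤ (n k : ℝ) ^ 2 := one_le_pow₀ (hn1 k)
      rw [Fintype.card_fin]
      calc 4 / Real.log 2 ^ 2 + Real.logb 2 (M (n k)) ^ 2
          ≤ 4 / Real.log 2 ^ 2 * (n k : ℝ) ^ 2 + ((Rp + Re + 1) * n k) ^ 2 :=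
            add_le_add (le_mul_of_one_le_right (by positivity) h3)
              (pow_le_pow_left₀ (hlog0 k) h2 2)
        _ = A * (n k : ℝ) ^ 2 := by rw [hA]; ring
        _ ≤ _ := by
            have := hn1 k
            gcongr
    refine (Finset.sum_le_sum fun k _ => hk k).trans ?_
    rw [Finset.sum_const, Finset.card_univ, Fintype.card_fin, nsmul_eq_mul]
    calc K * (A * (2 * N / K) ^ 2) = 64 * A * (N ^ 2 / (16 * K)) := by field_simp; ring
      _ ≤ K * ε ^ 2 * (N ^ 2 / (16 * K)) := by gcongr
      _ = _ := by field_simp; ring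
  obtain ⟨c', hc1, hc2⟩ := exists_code_of_concat (P := Fin P) (S := Fin S) ch
    (fun k => c (n k)) (finSigmaFinEquiv.trans (finCongr hnsum))
    (by simpa [hcard] using hle) (by simpa [hcard] using hge) (B := N * ε / 4) (by positivity) hV
  refine ⟨P, S, hP, hS, c', ?_, ?_, ?_, ?_⟩
  · rw [← Real.dist_eq, ← Metric.mem_closedBall, Real.closedBall_eq_Icc, Set.mem_Icc,
      le_div_iff₀ hN0, div_le_iff₀ hN0]
    constructor <;> linarith
  · rw [← Real.dist_eq, ← Metric.mem_closedBall, Real.closedBall_eq_Icc, Set.mem_Icc,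
      le_div_iff₀ hN0, div_le_iff₀ hN0]
    constructor <;> linarith
  · refine hc1.trans ?_
    have : ∑ k, (c (n k)).errorProb ch ≤ ∑ _k : Fin K, ε / (2 * K) :=
      Finset.sum_le_sum fun k _ => (hm _ (hnm k)).1.2.1
    rw [Finset.sum_const, Finset.card_univ, Fintype.card_fin, nsmul_eq_mul] at this
    have h : 2 * (K * (ε / (2 * K))) = ε := by field_simp
    linarith
  · rw [div_le_iff₀ hN0]
    refine hc2.trans ?_
    simp only [Fintype.card_fin]
    have hI : ∑ k, (Real.logb 2 (M (n k)) - (c (n k)).equivocation ch) ≤ (Rp + 2 * δ) * N := by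
      rw [← hnsumr, Finset.mul_sum]
      exact Finset.sum_le_sum fun k _ => by linarith [(hlog k).2, heq k]
    have hmax : max 0 (∑ k, (Real.logb 2 (M (n k)) - (c (n k)).equivocation ch) - Real.logb 2 P)
        ≤ 3 * (δ * N) + 1 := max_le (by positivity) (by linarith)
    linarith

/-- A diagonal argument: if `q n` takes arbitrarily small values for large `n`, then it tends to
zero along a suitable sequence. -/
lemma exists_seq_tendsto_zero {A : ℕ → Type*} [∀ n, Nonempty (A n)] (q : ∀ n, A n → ℝ)
    (h0 : ∀ n a, 0 ≤ q n a) (h : ∀ ε : ℝ, 0 < ε → ∀ᶠ n in atTop, ∃ a, q n a ≤ ε) :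
    ∃ a : ∀ n, A n, Tendsto (fun n => q n (a n)) atTop (𝓝 0) := by
  have hex : ∀ n : ℕ, ∃ a, q n a < (⨅ a, q n a) + 1 / ((n : ℝ) + 1) := fun n =>
    exists_lt_of_ciInf_lt (lt_add_of_pos_right _ Nat.one_div_pos_of_nat)
  choose a ha using hex
  refine ⟨a, Metric.tendsto_nhds.2 fun ε hε => ?_⟩
  filter_upwards [h (ε / 2) (by positivity),
    (tendsto_one_div_add_atTop_nhds_zero_nat (𝕜 := ℝ)).eventually
      (gt_mem_nhds (show (0 : ℝ) < ε / 2 by positivity))] with n ⟨b, hb⟩ hn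
  have h1 : ⨅ a, q n a ≤ q n b := ciInf_le ⟨0, by rintro _ ⟨a, rfl⟩; exact h0 n a⟩ b
  rw [Real.dist_eq, sub_zero, abs_of_nonneg (h0 _ _)]
  linarith [ha n]

theorem AchievableRateEquivocation.achievablePrivateConfidential {ch : Channel X Y Z}
    {Rp Rs : ℝ} (hRs : 0 ≤ Rs) (h : AchievableRateEquivocation ch (Rp + Rs) Rs) :
    AchievablePrivateConfidential ch Rp Rs := by
  obtain ⟨M, c, hM, hrate, herr, hequiv⟩ := h
  have hne : ∀ n, Nonempty (Fin (M n)) := fun n => ⟨⟨0, hM n⟩⟩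
  -- `0 ≤ Rp`, as the equivocation does not exceed the entropy of the message
  have hRp : 0 ≤ Rp := by
    refine le_of_forall_pos_le_add fun ε hε => ?_
    have hle : Rs - ε ≤ Rp + Rs := by
      refine ge_of_tendsto hrate ?_
      filter_upwards [hequiv ε hε] with n hn
      refine hn.trans (div_le_div_of_nonneg_right ?_ n.cast_nonneg)
      simpa using (c n).equivocation_le ch
    linarith
  let A : ℕ → Type _ := fun n => Σ m : ℕ+ × ℕ+, Code (Fin m.1 × Fin m.2) X Y n
  have hA : ∀ n, Nonempty (A n) := fun n =>
    ⟨⟨(1, 1), (c n).restrict (𝓥 := Fin 1 × Fin 1) fun _ => ⟨0, hM n⟩⟩⟩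
  let q : ∀ n, A n → ℝ := fun n a =>
    max (max |Real.logb 2 (a.1.1 : ℕ) / n - Rp| |Real.logb 2 (a.1.2 : ℕ) / n - Rs|)
      (max (a.2.errorProb ch) (a.2.leakage ch / n))
  obtain ⟨a, ha⟩ := exists_seq_tendsto_zero q
    (fun n a => (abs_nonneg _).trans ((le_max_left _ _).trans (le_max_left _ _))) (by
      intro ε hε
      filter_upwards [eventually_exists_code ch hRp hRs hM hrate herr hequiv hε] with N hN
      obtain ⟨P, S, hP, hS, c', h1, h2, h3, h4⟩ := hN
      exact ⟨⟨(⟨P, hP⟩, ⟨S, hS⟩), c'⟩, max_le (max_le h1 h2) (max_le h3 h4)⟩)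
  refine ⟨fun n => (a n).1.1, fun n => (a n).1.2, fun n => (a n).2,
    fun n => ⟨(a n).1.1.pos, (a n).1.2.pos⟩, ?_, ?_, ?_, ?_⟩
  · refine tendsto_iff_norm_sub_tendsto_zero.2 (squeeze_zero (fun _ => norm_nonneg _) (fun n => ?_) ha)
    exact (le_max_left _ _).trans (le_max_left _ _)
  · refine tendsto_iff_norm_sub_tendsto_zero.2 (squeeze_zero (fun _ => norm_nonneg _) (fun n => ?_) ha)
    exact (le_max_right _ _).trans (le_max_left _ _)
  · refine squeeze_zero (fun n => Code.errorProb_nonneg _ ch) (fun n => ?_) ha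
    exact (le_max_left _ _).trans (le_max_right _ _)
  · intro ε hε
    filter_upwards [ha.eventually (ge_mem_nhds hε)] with n hn
    exact ((le_max_right _ _).trans (le_max_right _ _)).trans hn

end Forward

/-! ### From confidential messages to equivocation -/

section Backward

variable {X Y Z : Type*} [Fintype X] [Fintype Y] [Fintype Z]

lemma condEntropy_comp_equiv {α α' β : Type*} [Fintype α] [Fintype α'] [Fintype β] (f : α' ≃ α)
    (p : α × β → ℝ) : condEntropy (fun q : α' × β => p (f q.1, q.2)) = condEntropy p := by
  simp only [condEntropy]
  rw [← Equiv.sum_comp f (fun a => ∑ b, p (a, b) * Real.logb 2 (p (a, b) / ∑ a', p (a', b)))]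
  simp only [fun b => Equiv.sum_comp f (fun a => p (a, b))]

/-- The equivocation of a message pair is at least that of its second component, which is the
difference of its entropy and the leakage. -/
lemma Code.logb_card_sub_leakage_le {P S : Type*} [Fintype P] [Fintype S] [Nonempty P] [Nonempty S]
    {n : ℕ} (c : Code (P × S) X Y n) (ch : Channel X Y Z) :
    Real.logb 2 (Fintype.card S) - c.leakage ch ≤ c.equivocation ch := by
  have hnn : ∀ q, 0 ≤ c.eavesdropper ch q := by
    rw [c.eavesdropper_eq]
    exact uniformJoint_nonneg (c.eveMatrix_nonneg ch)
  have hP : (0 : ℝ) < Fintype.card P := by exact_mod_cast Fintype.card_pos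
  have hS : (0 : ℝ) < Fintype.card S := by exact_mod_cast Fintype.card_pos
  refine le_trans (le_of_eq ?_) (condEntropy_marginal_le _ hnn)
  rw [condEntropy_eq_logb_card_sub _ (fun q => Finset.sum_nonneg fun _ _ => hnn _), Code.leakage]
  intro s
  rw [Finset.sum_comm]
  simp only [c.eavesdropper_eq, sum_uniformJoint (c.sum_eveMatrix ch), Finset.sum_const,
    Finset.card_univ, nsmul_eq_mul, Fintype.card_prod, Nat.cast_mul]
  field_simp

theorem AchievablePrivateConfidential.achievableRateEquivocation {ch : Channel X Y Z}
    {Rp Rs : ℝ} (h : AchievablePrivateConfidential ch Rp Rs) :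
    AchievableRateEquivocation ch (Rp + Rs) Rs := by
  obtain ⟨Mp, Ms, c, hM, hp, hs, herr, hleak⟩ := h
  have hnp : ∀ n, Nonempty (Fin (Mp n)) := fun n => ⟨⟨0, (hM n).1⟩⟩
  have hns : ∀ n, Nonempty (Fin (Ms n)) := fun n => ⟨⟨0, (hM n).2⟩⟩
  have hnm : ∀ n, Nonempty (Fin (Mp n * Ms n)) := fun n => ⟨⟨0, Nat.mul_pos (hM n).1 (hM n).2⟩⟩
  refine ⟨fun n => Mp n * Ms n, fun n => (c n).restrict finProdFinEquiv.symm,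
    fun n => Nat.mul_pos (hM n).1 (hM n).2, ?_, ?_, ?_⟩
  · refine (hp.add hs).congr fun n => ?_
    rw [Nat.cast_mul, Real.logb_mul (by exact_mod_cast (hM n).1.ne')
      (by exact_mod_cast (hM n).2.ne'), add_div]
  · refine squeeze_zero (fun n => Code.errorProb_nonneg _ ch) (fun n => ?_) herr
    refine (Code.errorProb_restrict_le (c n) ch finProdFinEquiv.symm.injective).trans (le_of_eq ?_)
    have : (Fintype.card (Fin (Mp n) × Fin (Ms n)) : ℝ) = Fintype.card (Fin (Mp n * Ms n)) := by
      simp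
    have h0 : (Fintype.card (Fin (Mp n * Ms n)) : ℝ) ≠ 0 := by
      exact_mod_cast Fintype.card_ne_zero
    rw [this, div_self h0, one_mul]
  · intro ε hε
    filter_upwards [hleak (ε / 2) (by positivity),
      hs.eventually (le_mem_nhds (show Rs - ε / 2 < Rs by linarith))] with n h1 h2
    have he : ((c n).restrict finProdFinEquiv.symm).equivocation ch = (c n).equivocation ch := by
      rw [Code.equivocation, Code.equivocation, ← condEntropy_comp_equiv finProdFinEquiv.symm]
      congr 1
      funext w
      simp [Code.eavesdropper, Code.joint, Code.restrict]
    have h3 := div_le_div_of_nonneg_right ((c n).logb_card_sub_leakage_le ch)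
      (n.cast_nonneg (α := ℝ))
    rw [Fintype.card_fin, sub_div] at h3
    rw [he]
    linarith

end Backward

end Wiretap

theorem fact1 {X Y Z : Type*} [Fintype X] [Fintype Y] [Fintype Z]
    (ch : Wiretap.Channel X Y Z) (R Re Rp Rs : ℝ) (hR : 0 ≤ R) (hRe : 0 ≤ Re)
    (hsum : R = Rp + Rs) (hs : Re = Rs) :
    Wiretap.AchievableRateEquivocation ch R Re ↔
      Wiretap.AchievablePrivateConfidential ch Rp Rs := by
  subst hsum hs
  exact ⟨fun h => h.achievablePrivateConfidential hRe, fun h => h.achievableRateEquivocation⟩
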